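/- Model. A request $I$ is active during $[s_I,e_I)$, has duration $e_I-s_I>0$ and size $w_I\in(0,1]$. An instance is a nonempty finite sequence of requests in order of arrival; $T$ is the length of its time horizon (from the first arrival to the last departure), and at every time of the horizon at least one request is active. Each request is assigned once and for all to a machine of capacity $1$, so that the total size of the active requests on a machine never exceeds $1$. The cost of a schedule is the total time during which machines are active (run at least one request), its average cost is its cost divided by $T$, and $\mathrm{OPT}_{avg}$ is the minimum average cost over all feasible schedules. Let $\mu$ be the ratio of the maximum to the minimum duration, $v_t=\lceil\sum_{I\ni t}w_I\rceil$ the load at time $t$, and $v_{avg}$ the average of $v_t$ over the horizon. Sizes are uniform if they all equal $1/g$ for some positive integer $g$. A clairvoyant online algorithm learns the duration and the size of a request on its arrival and must assign it immediately. Let $\Pi_k$ be the asymptotic competitive ratio of the static Harmonic bin packing algorithm with parameter $k$, that is, the infimum of all $c$ for which there is an $\ell$ such that Harmonic uses at most $c\cdot\mathrm{OPT}^S+\ell$ bins on every list of items with sizes in $(0,1]$, where $\mathrm{OPT}^S$ is the optimal number of bins. (Harmonic packs the items with sizes in $(\frac1{j+1},\frac1j]$ for each $j=1,\dots,k-1$,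 and those with sizes in $(0,\frac1k]$, separately by Next-Fit.) Theorem. There is an absolute constant $C>0$ such that: 1. (Average load.) For every $k\ge2$ there is a clairvoyant online algorithm that knows in advance, of the future, only the number $v_{avg}$, and produces on every instance a feasible schedule of average cost at most $$\Pi_k\cdot\mathrm{OPT}_{avg}+k\cdot C\sqrt{\mathrm{OPT}_{avg}\cdot(1+\log\mu)}.$$ There is also such an algorithm that on every instance with uniform sizes (with $g$ not known in advance) produces a feasible schedule of average cost at most $$\mathrm{OPT}_{avg}+C\sqrt{\mathrm{OPT}_{avg}\cdot(1+\log\mu)}.$$ 2. (Future load vector.) There is a clairvoyant online algorithm that at each arrival time $t$ is given the loads $v_{t'}$ for all $t'\in[t,t+L)$, where $L$ is the maximum duration, and produces on every instance a feasible schedule of average cost at most $8\cdot\mathrm{OPT}_{avg}$. There is also such an algorithm that on every instance with uniform sizes produces a feasible schedule of average cost at most $2\cdot\mathrm{OPT}_{avg}$. -/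

import Mathlib

noncomputable section

namespace DynamicBinPacking

/-! ### Static bin packing: Next-Fit, Harmonic and the asymptotic ratio of Harmonic -/

/-- A list of item sizes is valid if all sizes lie in `(0, 1]`. -/
def ValidItems (L : List ℝ) : Prop := ∀ w ∈ L, 0 < w ∧ w ≤ 1

/-- The optimal number of unit bins for the items in `L`. -/
def staticOpt (L : List ℝ) : ℕ :=
  sInf {m : ℕ | ∃ b : Fin L.length → Fin m, ∀ c : Fin m, ∑ i with b i = c, L.get i ≤ 1}

/-- One step of Next-Fit. The state is the number of bins opened so far and the level of the
active bin (the last one opened). -/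
def nextFitStep (s : ℕ × ℝ) (w : ℝ) : ℕ × ℝ :=
  if s.1 ≠ 0 ∧ s.2 + w ≤ 1 then (s.1, s.2 + w) else (s.1 + 1, w)

/-- The number of bins that Next-Fit opens on the item sequence `L`. -/
def nextFitBins (L : List ℝ) : ℕ := (L.foldl nextFitStep (0, 0)).1

/-- The subsequence of the items of harmonic class `j ∈ {1, …, k}`: sizes in `(1/(j+1), 1/j]` for
`j < k`, and sizes in `(0, 1/k]` for `j = k`. -/
def harmonicClass (k j : ℕ) (L : List ℝ) : List ℝ :=
  L.filter fun w => (j = k ∨ 1 / ((j : ℝ) + 1) < w) ∧ w ≤ 1 / (j : ℝ)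

/-- The number of bins that the Harmonic algorithm with parameter `k` opens on `L`: each class is
packed separately by Next-Fit. -/
def harmonicBins (k : ℕ) (L : List ℝ) : ℕ :=
  ∑ j ∈ Finset.Icc 1 k, nextFitBins (harmonicClass k j L)

/-- `Π_k`, the asymptotic competitive ratio of the Harmonic algorithm with parameter `k`: the
infimum of the `c` such that Harmonic uses at most `c * OPT + ℓ` bins for some constant `ℓ`. -/
def harmonicRatio (k : ℕ) : ℝ :=
  sInf {c : ℝ | ∃ l : ℝ, ∀ L : List ℝ, ValidItems L →
    (harmonicBins k L : ℝ) ≤ c * (staticOpt L : ℝ) + l}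

/-! ### Dynamic bin packing -/

/-- A request (item): it is active during `[start, finish)` and occupies `size` of its machine. -/
structure Request where
  start : ℝ
  finish : ℝ
  size : ℝ

/-- The time interval in which a request is active. -/
def Request.span (r : Request) : Set ℝ := Set.Ico r.start r.finish

/-- The duration of a request. -/
def Request.length (r : Request) : ℝ := r.finish - r.start

/-- An instance: a nonempty finite sequence of requests in their order of arrival (simultaneous
requests are presented one after the other), such that at each time of the time horizon at least
one request is active. -/
structure Instance where
  n : ℕ
  n_pos : 0 < n
  req : Fin n → Request
  start_lt_finish : ∀ i, (req i).start < (req i).finish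
  size_pos : ∀ i, 0 < (req i).size
  size_le_one : ∀ i, (req i).size ≤ 1
  start_mono : Monotone fun i => (req i).start
  busy : ∀ t : ℝ, (∃ i, (req i).start ≤ t) → (∃ i, t < (req i).finish) → ∃ i, t ∈ (req i).span

namespace Instance

variable (I : Instance)

/-- The length `T` of the time horizon. -/
def horizon : ℝ := (⨆ i, (I.req i).finish) - ⨅ i, (I.req i).start

/-- The maximum duration. -/
def maxLength : ℝ := ⨆ i, (I.req i).length

/-- The minimum duration. -/
def minLength : ℝ := ⨅ i, (I.req i).length

/-- `μ`, the ratio of the maximum to the minimum duration. -/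
def mu : ℝ := I.maxLength / I.minLength

/-- All sizes are equal to `1 / g` for some positive integer `g`. -/
def Uniform : Prop := ∃ g : ℕ, 0 < g ∧ ∀ i, (I.req i).size = 1 / (g : ℝ)

/-- The total size of the requests that are active at time `t`. -/
def load (t : ℝ) : ℝ := ∑ i, (I.req i).span.indicator (fun _ => (I.req i).size) t

/-- The load vector `v_t`: the total active size, rounded up. -/
def loadVec (t : ℝ) : ℕ := ⌈I.load t⌉₊

/-- The average load `v_avg`. -/
def avgLoad : ℝ := (∫ t, (I.loadVec t : ℝ)) / I.horizon

/-- A schedule assigns each request to a machine, once and for all. It is feasible if at no time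
the total size on a machine exceeds `1`. -/
def Feasible (σ : Fin I.n → ℕ) : Prop :=
  ∀ (t : ℝ) (m : ℕ),
    ∑ i with σ i = m, (I.req i).span.indicator (fun _ => (I.req i).size) t ≤ 1

/-- The set of times at which machine `m` is active, that is, runs at least one request. -/
def activeTimes (σ : Fin I.n → ℕ) (m : ℕ) : Set ℝ := {t | ∃ i, σ i = m ∧ t ∈ (I.req i).span}

/-- The cost of a schedule: the total time that the machines are active. -/
def cost (σ : Fin I.n → ℕ) : ℝ :=
  ∑ m ∈ Finset.univ.image σ, MeasureTheory.volume.real (I.activeTimes σ m)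

/-- The cost of an optimal (offline) schedule. -/
def opt : ℝ := sInf {c : ℝ | ∃ σ : Fin I.n → ℕ, I.Feasible σ ∧ c = I.cost σ}

/-- The average cost of a schedule over the time horizon. -/
def avgCost (σ : Fin I.n → ℕ) : ℝ := I.cost σ / I.horizon

/-- `OPT_avg`. -/
def optAvg : ℝ := I.opt / I.horizon

/-- The load prediction available when request `i` arrives, at time `s`: the values of the load
vector of the whole instance on `[s, s + maximum duration)`. -/
def forecast (i : Fin I.n) : ℝ → ℕ :=
  (Set.Ico (I.req i).start ((I.req i).start + I.maxLength)).indicator I.loadVec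

end Instance

/-- A (deterministic, clairvoyant) online algorithm that knows the average load: given the average
load and the requests that have arrived so far, with their durations and sizes, it chooses the
machine of the request that has arrived last. -/
def AvgLoadAlgorithm : Type := ℝ → List Request → ℕ

/-- The schedule produced by the algorithm when the average load is known. -/
def AvgLoadAlgorithm.run (A : AvgLoadAlgorithm) (I : Instance) (i : Fin I.n) : ℕ :=
  A I.avgLoad ((List.ofFn I.req).take (i + 1))

/-- A (deterministic, clairvoyant) online algorithm that knows the future load vector: given the
requests that have arrived so far, each together with the load prediction that was available on its
arrival, it chooses the machine of the request that has arrived last. -/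
def LoadVectorAlgorithm : Type := List (Request × (ℝ → ℕ)) → ℕ

/-- The schedule produced by the algorithm when the future load vector is known. -/
def LoadVectorAlgorithm.run (A : LoadVectorAlgorithm) (I : Instance) (i : Fin I.n) : ℕ :=
  A ((List.ofFn fun j => (I.req j, I.forecast j)).take (i + 1))

end DynamicBinPacking

end

/-!
The cost of a schedule is the integral over time of the number of active machines, so schedules
are compared time by time. A feasible schedule has at least `v_t` active machines at time `t`
(`Instance.loadVec_le_card`), and at least as many as an optimal static packing of the active
requests has bins (`Instance.staticOpt_active_le`).

**Known load vector.** The region below the load profile is cut into strips of height `1`. An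
arriving request goes to the lowest strip `h` from which it cannot be lifted: at some time of its
activity, the requests above strip `h` together with the new one would no longer fit into the part
of the profile above strip `h`. At that time the strip itself therefore has load less than `1`
plus the size of the request (`Instance.exists_loadOn_strip_lt`), hence at most `1` if the sizes
are uniform. Since each request of the strip has such a witness, the load of the strip is at most
twice that bound at every time (`Instance.loadOn_le_two_mul`): for each `t`, one argues with the
latest witness before `t` and the earliest one after `t`. So First Fit packs a strip into two
machines if the sizes are uniform, and into six if the sizes are at most `1 / 2`; larger requests
get their own machines, and no schedule can put two of those together. Strip `h` is in use only
while `v_t > h`.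

**Known average load `v`.** Durations are classified by powers of two relative to the duration of
the first request, which leads to classes `q` with `|q| + 1 ≤ P = 2 * (1 + log μ)`. The quota of
the class is `θ = √(v / (|q| + 1))`, and the quotas add up to `O(√(v * P))`.

* If `θ ≥ 1`, the requests are grouped by their class, their harmonic size class, and a departure
  window whose length is about `1 / θ` times the duration, and each group is packed by Next-Fit.
  There are `O(k * √(v * P))` groups at a time. Before the departure window of a group, none of
  its requests has departed, so its machines are those of a static Next-Fit packing of active
  requests; taken together, these are at most the bins of Harmonic for the active requests, up to
  one bin per group (`sum_nextFitBins_le`). The rest of the time is charged to the volume of the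
  requests at the rate `1 / θ`.
* If `θ < 1`, the class may use up to the load `θ` in a shared First-Fit pool, which costs
  `O(√(v * P))` machines. When the quota is exhausted, the requests of the class pay for
  additional machines, again at the rate `1 / θ`; so do requests larger than `θ / 2`, each on its
  own machine.

As `1 / θ ≤ √(P / v)` and the total volume is at most `v` times the horizon, the charges amount to
`O(√(v * P))` on average, and `v ≤ OPT_avg`. Harmonic is compared with the optimum by
`harmonicBins_le`: the ratio `Π_k` is attained with the additive constant `k`, as one sees by
packing many copies of the same list. For uniform sizes, Next-Fit in the groups (with `k = 1`)
leaves at most one bin per group incomplete.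
-/

noncomputable section

namespace DynamicBinPacking

open MeasureTheory Set

/-! ### Online rules -/

/-- The run of an online rule on an input sequence: each input is recorded together with the
decision that the rule takes on the basis of the earlier inputs and decisions. -/
def history {α β : Type*} (rule : List (α × β) → α → β) (l : List α) : List (α × β) :=
  l.foldl (fun h x => h ++ [(x, rule h x)]) []

/-- The decision on the last element of an input sequence. -/
def lastDecision {α β : Type*} [Inhabited β] (rule : List (α × β) → α → β) (l : List α) : β :=
  (l.getLast?.map (rule (history rule l.dropLast))).getD default

/-- The decision taken on the `i`-th element of the finite input sequence `f`. -/
def decision {α β : Type*} (rule : List (α × β) → α → β) {n : ℕ} (f : Fin n → α) (i : Fin n) : β :=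
  rule (history rule ((List.ofFn f).take i)) (f i)

lemma history_append_singleton {α β : Type*} (rule : List (α × β) → α → β) (l : List α) (x : α) :
    history rule (l ++ [x]) = history rule l ++ [(x, rule (history rule l) x)] := by
  simp [history]

lemma take_succ_ofFn {α : Type*} {n : ℕ} (f : Fin n → α) (i : Fin n) :
    (List.ofFn f).take (i + 1) = (List.ofFn f).take i ++ [f i] := by
  rw [List.take_add_one]
  simp

lemma lastDecision_take {α β : Type*} [Inhabited β] (rule : List (α × β) → α → β) {n : ℕ}
    (f : Fin n → α) (i : Fin n) :
    lastDecision rule ((List.ofFn f).take (i + 1)) = decision rule f i := by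
  rw [take_succ_ofFn]
  simp [lastDecision, decision]

lemma history_take {α β : Type*} (rule : List (α × β) → α → β) {n : ℕ} (f : Fin n → α) (i : ℕ)
    (hi : i ≤ n) :
    history rule ((List.ofFn f).take i) =
      ((List.finRange n).take i).map fun j => (f j, decision rule f j) := by
  induction i with
  | zero => simp [history]
  | succ i ih =>
    have h1 := take_succ_ofFn f ⟨i, hi⟩
    have h2 := take_succ_ofFn (id : Fin n → Fin n) ⟨i, hi⟩
    rw [List.ofFn_id] at h2
    simp only [id] at h1 h2
    rw [h1, history_append_singleton, ih (by omega), h2, List.map_append]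
    simp [decision, ih (show i ≤ n by omega)]

/-- A decision is the value of the rule at the earlier inputs and decisions. -/
lemma decision_eq {α β : Type*} (rule : List (α × β) → α → β) {n : ℕ} (f : Fin n → α)
    (i : Fin n) :
    decision rule f i =
      rule (((List.finRange n).take i).map fun j => (f j, decision rule f j)) (f i) := by
  rw [← history_take rule f i i.2.le, decision]

lemma sum_map_take_finRange {n : ℕ} (F : Fin n → ℝ) (i : ℕ) (hi : i ≤ n) :
    (((List.finRange n).take i).map F).sum =
      ∑ j ∈ Finset.univ.filter (fun j : Fin n => (j : ℕ) < i), F j := by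
  induction i with
  | zero => simp
  | succ i ih =>
    have h2 := take_succ_ofFn (id : Fin n → Fin n) ⟨i, hi⟩
    rw [List.ofFn_id] at h2
    simp only [id] at h2
    rw [h2, List.map_append, List.sum_append, ih (by omega)]
    have : (Finset.univ.filter fun j : Fin n => (j : ℕ) < i + 1) =
        insert ⟨i, hi⟩ (Finset.univ.filter fun j : Fin n => (j : ℕ) < i) := by
      ext j; simp [Fin.ext_iff]; omega
    rw [this, Finset.sum_insert (by simp)]
    simp [add_comm]

/-! ### Active requests and the cost of a schedule -/

namespace Instance

variable (I : Instance)

/-- The set of requests that are active at time `t`. -/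
def active (t : ℝ) : Finset (Fin I.n) := open Classical in {i | t ∈ (I.req i).span}

variable {I} in
@[simp] lemma mem_active {t : ℝ} {i : Fin I.n} :
    i ∈ I.active t ↔ (I.req i).start ≤ t ∧ t < (I.req i).finish := by
  simp [active, Request.span]

/-- The total size of the requests in `s` that are active at time `t`. -/
def loadOn (p : Fin I.n → Prop) (t : ℝ) : ℝ :=
  open Classical in ∑ i ∈ I.active t with p i, (I.req i).size

/-- The first arrival time. -/
def first : ℝ := ⨅ i, (I.req i).start

/-- The last departure time. -/
def last : ℝ := ⨆ i, (I.req i).finish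

instance : Nonempty (Fin I.n) := ⟨⟨0, I.n_pos⟩⟩

lemma first_le (i : Fin I.n) : I.first ≤ (I.req i).start :=
  ciInf_le (Set.finite_range _).bddBelow i

lemma le_last (i : Fin I.n) : (I.req i).finish ≤ I.last :=
  le_ciSup (Set.finite_range fun i => (I.req i).finish).bddAbove i

lemma horizon_eq : I.horizon = I.last - I.first := rfl

lemma horizon_pos : 0 < I.horizon := by
  have i : Fin I.n := ⟨0, I.n_pos⟩
  have := I.first_le i
  have := I.le_last i
  have := I.start_lt_finish i
  rw [horizon_eq]; linarith

lemma active_nonempty_iff {t : ℝ} : (I.active t).Nonempty ↔ t ∈ Ico I.first I.last := by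
  constructor
  · rintro ⟨i, hi⟩
    rw [mem_active] at hi
    exact ⟨(I.first_le i).trans hi.1, hi.2.trans_le (I.le_last i)⟩
  · rintro ⟨h1, h2⟩
    obtain ⟨i, hi⟩ : ∃ i, (I.req i).start = I.first := exists_eq_ciInf_of_finite
    obtain ⟨j, hj⟩ : ∃ j, (I.req j).finish = I.last := exists_eq_ciSup_of_finite
    obtain ⟨k, hk⟩ := I.busy t ⟨i, hi.trans_le h1⟩ ⟨j, h2.trans_eq hj.symm⟩
    exact ⟨k, mem_active.2 hk⟩

lemma loadOn_eq_sum_ite (p : Fin I.n → Prop) [DecidablePred p] (t : ℝ) :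
    I.loadOn p t = ∑ i with p i, (I.req i).span.indicator (fun _ => (I.req i).size) t := by
  classical
  simp only [loadOn, active, Set.indicator_apply, Finset.sum_filter]
  rw [Finset.sum_congr rfl]
  intro i _
  split_ifs <;> rfl

lemma loadOn_eq_sum (p : Fin I.n → Prop) [DecidablePred p] (t : ℝ) :
    I.loadOn p t = ∑ i ∈ I.active t with p i, (I.req i).size := by
  rw [loadOn]; congr!

lemma loadOn_le_sum {p : Fin I.n → Prop} {t : ℝ} {s : Finset (Fin I.n)}
    (hs : ∀ i ∈ I.active t, p i → i ∈ s) : I.loadOn p t ≤ ∑ i ∈ s, (I.req i).size := by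
  classical
  rw [loadOn_eq_sum]
  refine Finset.sum_le_sum_of_subset_of_nonneg (fun i hi => ?_) fun i _ _ => (I.size_pos i).le
  rw [Finset.mem_filter] at hi
  exact hs i hi.1 hi.2

lemma sum_le_loadOn {p : Fin I.n → Prop} {t : ℝ} {s : Finset (Fin I.n)}
    (hs : ∀ i ∈ s, i ∈ I.active t ∧ p i) : ∑ i ∈ s, (I.req i).size ≤ I.loadOn p t := by
  classical
  rw [loadOn_eq_sum]
  refine Finset.sum_le_sum_of_subset_of_nonneg (fun i hi => ?_) fun i _ _ => (I.size_pos i).le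
  rw [Finset.mem_filter]
  exact hs i hi

lemma load_eq (t : ℝ) : I.load t = ∑ i ∈ I.active t, (I.req i).size := by
  classical
  simp [load, active, Set.indicator_apply, Finset.sum_filter]

lemma loadOn_le_loadOn {p p' : Fin I.n → Prop} {t t' : ℝ}
    (h : ∀ i ∈ I.active t, p i → i ∈ I.active t' ∧ p' i) : I.loadOn p t ≤ I.loadOn p' t' := by
  classical
  rw [I.loadOn_eq_sum p]
  refine I.sum_le_loadOn fun i hi => ?_
  rw [Finset.mem_filter] at hi
  exact h i hi.1 hi.2

lemma loadOn_mono {p p' : Fin I.n → Prop} {t : ℝ} (h : ∀ i, p i → p' i) :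
    I.loadOn p t ≤ I.loadOn p' t :=
  I.loadOn_le_loadOn fun i hi hp => ⟨hi, h i hp⟩

lemma loadOn_eq_zero {p : Fin I.n → Prop} {t : ℝ} (h : ∀ i ∈ I.active t, ¬ p i) :
    I.loadOn p t = 0 := by
  classical
  rw [loadOn_eq_sum, Finset.filter_false_of_mem h, Finset.sum_empty]

lemma loadOn_le_add {p p₁ p₂ : Fin I.n → Prop} {t : ℝ} (h : ∀ i, p i → p₁ i ∨ p₂ i) :
    I.loadOn p t ≤ I.loadOn p₁ t + I.loadOn p₂ t := by
  classical
  rw [I.loadOn_eq_sum p, ← Finset.sum_filter_add_sum_filter_not _ p₁]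
  refine add_le_add (I.sum_le_loadOn fun i hi => ?_) (I.sum_le_loadOn fun i hi => ?_)
  all_goals simp only [Finset.mem_filter] at hi
  · exact ⟨hi.1.1, hi.2⟩
  · exact ⟨hi.1.1, (h i hi.1.2).resolve_left hi.2⟩

lemma loadOn_add_le {p p₁ p₂ : Fin I.n → Prop} {t : ℝ} (h₁ : ∀ i, p₁ i → p i)
    (h₂ : ∀ i, p₂ i → p i) (h : ∀ i, p₁ i → ¬ p₂ i) :
    I.loadOn p₁ t + I.loadOn p₂ t ≤ I.loadOn p t := by
  classical
  rw [I.loadOn_eq_sum p, ← Finset.sum_filter_add_sum_filter_not _ p₁]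
  refine add_le_add (I.loadOn_le_sum fun i hi hp => ?_) (I.loadOn_le_sum fun i hi hp => ?_)
  all_goals simp only [Finset.mem_filter]
  · exact ⟨⟨hi, h₁ i hp⟩, hp⟩
  · exact ⟨⟨hi, h₂ i hp⟩, fun h' => h i h' hp⟩

lemma exists_last_active {p : Fin I.n → Prop} {t : ℝ} (h : ∃ i ∈ I.active t, p i) :
    ∃ i ∈ I.active t, p i ∧ ∀ j ∈ I.active t, p j → j ≤ i := by
  classical
  obtain ⟨i, hi, hp⟩ := h
  obtain ⟨k, hk, hmax⟩ := Finset.exists_max_image ((I.active t).filter p) id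
    ⟨i, Finset.mem_filter.2 ⟨hi, hp⟩⟩
  rw [Finset.mem_filter] at hk
  exact ⟨k, hk.1, hk.2, fun j hj hpj => hmax j (Finset.mem_filter.2 ⟨hj, hpj⟩)⟩

lemma loadOn_le_before_add {p : Fin I.n → Prop} {t : ℝ} {i : Fin I.n}
    (h : ∀ j ∈ I.active t, p j → j ≤ i) :
    I.loadOn p t ≤ I.loadOn (fun j => j < i ∧ p j) t + (I.req i).size := by
  classical
  refine (I.loadOn_le_sum (s := insert i
    (Finset.filter (fun j => j < i ∧ p j) (I.active t))) fun j hj hp => ?_).trans ?_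
  · rw [Finset.mem_insert, Finset.mem_filter]
    rcases (h j hj hp).eq_or_lt with h | h
    · exact Or.inl h
    · exact Or.inr ⟨hj, h, hp⟩
  · rw [Finset.sum_insert (by simp), loadOn_eq_sum, add_comm]

lemma loadOn_nonneg (p : Fin I.n → Prop) (t : ℝ) : 0 ≤ I.loadOn p t :=
  Finset.sum_nonneg fun i _ => (I.size_pos i).le

lemma loadOn_le_load (p : Fin I.n → Prop) (t : ℝ) : I.loadOn p t ≤ I.load t := by
  rw [load_eq]
  exact I.loadOn_le_sum fun i hi _ => hi

lemma load_le_loadVec (t : ℝ) : I.load t ≤ I.loadVec t := Nat.le_ceil _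

lemma feasible_iff (σ : Fin I.n → ℕ) :
    I.Feasible σ ↔ ∀ t m, I.loadOn (fun i => σ i = m) t ≤ 1 := by
  simp only [Feasible, loadOn_eq_sum_ite]

/-- Load bounds have to be checked at arrivals only: if the requests satisfying `p` never push
their own total size above `c` when they arrive, then that size never exceeds `c`. -/
lemma loadOn_le_of_arrivals {p : Fin I.n → Prop} {c : ℝ} (hc : 0 ≤ c)
    (h : ∀ i, p i → I.loadOn (fun j => j < i ∧ p j) (I.req i).start + (I.req i).size ≤ c) (t : ℝ) :
    I.loadOn p t ≤ c := by
  by_cases hne : ∃ i ∈ I.active t, p i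
  · obtain ⟨i, hi, hp, hmax⟩ := I.exists_last_active hne
    refine (I.loadOn_le_before_add hmax).trans (le_trans ?_ (h i hp))
    gcongr
    refine I.loadOn_le_loadOn fun j hj hpj => ⟨?_, hpj⟩
    rw [mem_active] at hi hj ⊢
    exact ⟨I.start_mono hpj.1.le, hi.1.trans_lt hj.2⟩
  · push Not at hne
    rw [I.loadOn_eq_zero hne]
    exact hc

/-- The labels of the requests that are active at time `t`. -/
def activeLabels {B : Type*} (lab : Fin I.n → B) (t : ℝ) : Finset B :=
  open Classical in (I.active t).image lab

variable {I} in
lemma mem_activeLabels {B : Type*} {lab : Fin I.n → B} {t : ℝ} {b : B} :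
    b ∈ I.activeLabels lab t ↔ ∃ i ∈ I.active t, lab i = b := by
  simp [activeLabels]

lemma activeLabels_eq {B : Type*} [DecidableEq B] (lab : Fin I.n → B) (t : ℝ) :
    I.activeLabels lab t = (I.active t).image lab := by
  ext; simp [activeLabels]

lemma measurableSet_active_eq (s : Finset (Fin I.n)) : MeasurableSet {t | I.active t = s} := by
  have : {t | I.active t = s} = ⋂ i, {t | t ∈ (I.req i).span ↔ i ∈ s} := by
    ext t
    simp [active, Finset.ext_iff]
  rw [this]
  refine MeasurableSet.iInter fun i => ?_
  by_cases hi : i ∈ s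
  · simp only [hi, iff_true]; exact measurableSet_Ico
  · simp only [hi, iff_false]; exact measurableSet_Ico.compl

/-- A quantity that depends only on the set of active requests is integrable, if it vanishes when
there are none. -/
lemma integrable_comp_active (G : Finset (Fin I.n) → ℝ) (hG : G ∅ = 0) :
    Integrable fun t => G (I.active t) := by
  classical
  have h1 : Measurable fun t => G (I.active t) := by
    have : (fun t => G (I.active t)) =
        fun t => ∑ s, {t | I.active t = s}.indicator (fun _ => G s) t := by
      ext t
      simp [Set.indicator_apply]
    rw [this]
    exact Finset.measurable_sum _ fun s _ =>
      measurable_const.indicator (I.measurableSet_active_eq s)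
  obtain ⟨C, hC⟩ := (Set.finite_range fun s => |G s|).bddAbove
  have : (fun t => G (I.active t)) = (Ico I.first I.last).indicator fun t => G (I.active t) := by
    ext t
    rw [Set.indicator_apply]
    split_ifs with h
    · rfl
    · rw [← active_nonempty_iff, Finset.not_nonempty_iff_eq_empty] at h
      rw [h, hG]
  rw [this, integrable_indicator_iff measurableSet_Ico]
  refine Measure.integrableOn_of_bounded (M := C) (by simp) h1.aestronglyMeasurable ?_
  exact Filter.Eventually.of_forall fun t => hC ⟨_, rfl⟩

lemma integrable_card_activeLabels {B : Type*} (lab : Fin I.n → B) :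
    Integrable fun t => ((I.activeLabels lab t).card : ℝ) := by
  classical
  exact I.integrable_comp_active (fun s => ((s.image lab).card : ℝ)) (by simp)

lemma integrable_loadVec : Integrable fun t => (I.loadVec t : ℝ) := by
  have := I.integrable_comp_active (fun s => (⌈∑ i ∈ s, (I.req i).size⌉₊ : ℝ)) (by simp)
  simpa only [loadVec, load_eq] using this

lemma integral_indicator_Ico_const (a b c : ℝ) (h : a ≤ b) :
    ∫ t, (Ico a b).indicator (fun _ => c) t = c * (b - a) := by
  rw [integral_indicator measurableSet_Ico]
  simp [h, mul_comm]

lemma integrable_indicator_Ico_const (a b c : ℝ) :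
    Integrable ((Ico a b).indicator fun _ : ℝ => c) := by
  rw [integrable_indicator_iff measurableSet_Ico]
  simp

/-- The cost of a schedule is the integral over time of the number of active machines. -/
lemma cost_eq_integral {B : Type*} (lab : Fin I.n → B) (e : B → ℕ) (he : Function.Injective e) :
    I.cost (fun i => e (lab i)) = ∫ t, ((I.activeLabels lab t).card : ℝ) := by
  classical
  set σ : Fin I.n → ℕ := fun i => e (lab i)
  have hmeas : ∀ m, MeasurableSet (I.activeTimes σ m) := by
    intro m
    have : I.activeTimes σ m = ⋃ i, ⋃ (_ : σ i = m), (I.req i).span := by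
      ext t; simp [activeTimes]
    rw [this]
    exact MeasurableSet.iUnion fun i => MeasurableSet.iUnion fun _ => measurableSet_Ico
  have hsub : ∀ m, I.activeTimes σ m ⊆ Ico I.first I.last := by
    rintro m t ⟨i, -, hi⟩
    exact I.active_nonempty_iff.1 ⟨i, mem_active.2 hi⟩
  have hfin : ∀ m, volume (I.activeTimes σ m) ≠ ⊤ := fun m =>
    ne_top_of_le_ne_top (by simp) (measure_mono (hsub m))
  have h1 : ∀ t, ((I.activeLabels lab t).card : ℝ) =
      ∑ m ∈ Finset.univ.image σ, (I.activeTimes σ m).indicator (fun _ => (1 : ℝ)) t := by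
    intro t
    have : (I.activeLabels lab t).card =
        ((Finset.univ.image σ).filter fun m => t ∈ I.activeTimes σ m).card := by
      rw [← Finset.card_image_of_injective _ he]
      congr 1
      ext m
      simp only [activeLabels, Finset.mem_image, mem_active, Finset.mem_filter, activeTimes,
        Finset.mem_univ, true_and, Request.span, Set.mem_Ico, Set.mem_ofPred_eq]
      constructor
      · rintro ⟨_, ⟨i, hi, rfl⟩, rfl⟩
        exact ⟨⟨i, rfl⟩, i, rfl, hi⟩
      · rintro ⟨-, i, rfl, hi⟩
        exact ⟨lab i, ⟨i, hi, rfl⟩, rfl⟩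
    rw [this, Finset.card_filter]
    push_cast
    simp [Set.indicator_apply]
  simp_rw [h1]
  rw [integral_finsetSum]
  · rw [cost]
    refine Finset.sum_congr rfl fun m _ => ?_
    rw [integral_indicator (hmeas m)]
    simp
  · intro m _
    rw [integrable_indicator_iff (hmeas m)]
    exact integrableOn_const (hfin m)

lemma cost_eq_integral_self (σ : Fin I.n → ℕ) :
    I.cost σ = ∫ t, ((I.activeLabels σ t).card : ℝ) :=
  I.cost_eq_integral σ id Function.injective_id

/-! ### Lower bounds on the optimum -/

lemma loadVec_le_card {σ : Fin I.n → ℕ} (hσ : I.Feasible σ) (t : ℝ) :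
    I.loadVec t ≤ (I.activeLabels σ t).card := by
  classical
  rw [loadVec, Nat.ceil_le, load_eq, activeLabels_eq]
  rw [feasible_iff] at hσ
  rw [← Finset.sum_fiberwise_of_maps_to (g := σ) fun i hi => Finset.mem_image_of_mem σ hi]
  calc _ ≤ ∑ m ∈ (I.active t).image σ, (1 : ℝ) := by
        refine Finset.sum_le_sum fun m _ => ?_
        have := hσ t m
        rwa [loadOn_eq_sum] at this
    _ = _ := by simp

lemma card_large_le_card {σ : Fin I.n → ℕ} (hσ : I.Feasible σ) (t : ℝ) (s : Finset (Fin I.n))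
    (hs : s ⊆ I.active t) (hw : ∀ i ∈ s, 1 / 2 < (I.req i).size) :
    s.card ≤ (I.activeLabels σ t).card := by
  classical
  refine Finset.card_le_card_of_injOn σ (fun i hi => ?_) ?_
  · exact mem_activeLabels.2 ⟨i, hs hi, rfl⟩
  intro i hi j hj hij
  by_contra hne
  have h := (I.feasible_iff σ).1 hσ t (σ i)
  have h2 : ∑ x ∈ ({i, j} : Finset (Fin I.n)), (I.req x).size ≤
      I.loadOn (fun x => σ x = σ i) t := by
    refine I.sum_le_loadOn fun x hx => ?_
    rw [Finset.mem_insert, Finset.mem_singleton] at hx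
    rcases hx with rfl | rfl
    · exact ⟨hs hi, rfl⟩
    · exact ⟨hs hj, hij.symm⟩
  rw [Finset.sum_pair hne] at h2
  have := hw i hi
  have := hw j hj
  linarith

lemma feasible_val : I.Feasible (fun i => (i : ℕ)) := by
  classical
  rw [feasible_iff]
  intro t m
  by_cases hm : m < I.n
  · refine (I.loadOn_le_sum (s := {⟨m, hm⟩}) fun i _ hi => ?_).trans ?_
    · simp [Fin.ext_iff, hi]
    · simpa using I.size_le_one _
  · refine (I.loadOn_le_sum (s := ∅) fun i _ hi => ?_).trans (by simp)
    have := i.2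
    omega

lemma cost_nonneg (σ : Fin I.n → ℕ) : 0 ≤ I.cost σ :=
  Finset.sum_nonneg fun _ _ => measureReal_nonneg

lemma le_opt {x : ℝ} (h : ∀ σ, I.Feasible σ → x ≤ I.cost σ) : x ≤ I.opt := by
  refine le_csInf ⟨_, _, I.feasible_val, rfl⟩ ?_
  rintro _ ⟨σ, hσ, rfl⟩
  exact h σ hσ

lemma le_mul_opt_add {x a b : ℝ} (ha : 0 ≤ a)
    (h : ∀ σ, I.Feasible σ → x ≤ a * I.cost σ + b) : x ≤ a * I.opt + b := by
  rcases ha.eq_or_lt with rfl | ha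
  · simpa using h _ I.feasible_val
  · have := I.le_opt (x := (x - b) / a) fun σ hσ => by
      rw [div_le_iff₀ ha]
      linarith [h σ hσ]
    rw [div_le_iff₀ ha] at this
    linarith

lemma optAvg_nonneg : 0 ≤ I.optAvg :=
  div_nonneg (I.le_opt fun σ _ => I.cost_nonneg σ) I.horizon_pos.le

lemma avgLoad_mul_horizon : I.avgLoad * I.horizon = ∫ t, (I.loadVec t : ℝ) :=
  div_mul_cancel₀ _ I.horizon_pos.ne'

lemma integral_loadVec_le_cost {σ : Fin I.n → ℕ} (hσ : I.Feasible σ) :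
    ∫ t, (I.loadVec t : ℝ) ≤ I.cost σ := by
  rw [cost_eq_integral_self]
  exact integral_mono I.integrable_loadVec (I.integrable_card_activeLabels σ)
    fun t => Nat.cast_le.2 (I.loadVec_le_card hσ t)

lemma avgLoad_le_optAvg : I.avgLoad ≤ I.optAvg :=
  div_le_div_of_nonneg_right (I.le_opt fun _ hσ => I.integral_loadVec_le_cost hσ) I.horizon_pos.le

lemma integral_horizon (c : ℝ) :
    ∫ t, (Ico I.first I.last).indicator (fun _ => c) t = c * I.horizon := by
  rw [integral_indicator_Ico_const _ _ _ (by linarith [I.horizon_pos, I.horizon_eq]), horizon_eq]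

lemma one_le_loadVec {t : ℝ} (ht : (I.active t).Nonempty) : 1 ≤ I.loadVec t := by
  rw [loadVec, Nat.one_le_ceil_iff, load_eq]
  exact Finset.sum_pos (fun i _ => I.size_pos i) ht

lemma one_le_avgLoad : 1 ≤ I.avgLoad := by
  rw [avgLoad, le_div_iff₀ I.horizon_pos, ← integral_horizon]
  refine integral_mono (integrable_indicator_Ico_const _ _ _) I.integrable_loadVec fun t => ?_
  rw [Set.indicator_apply]
  split_ifs with h
  · simpa using I.one_le_loadVec (I.active_nonempty_iff.2 h)
  · positivity

/-- The total volume (size times duration) of the requests is at most the integral of the load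
vector. -/
lemma volume_le : ∑ i, (I.req i).size * (I.req i).length ≤ I.avgLoad * I.horizon := by
  rw [avgLoad_mul_horizon]
  have h : ∫ t, I.load t = ∑ i, (I.req i).size * (I.req i).length := by
    simp only [load, Request.span]
    rw [integral_finsetSum _ fun i _ => integrable_indicator_Ico_const _ _ _]
    exact Finset.sum_congr rfl fun i _ =>
      integral_indicator_Ico_const _ _ _ (I.start_lt_finish i).le
  rw [← h]
  refine integral_mono ?_ I.integrable_loadVec I.load_le_loadVec
  exact integrable_finsetSum _ fun i _ => integrable_indicator_Ico_const _ _ _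

end Instance

/-! ### First Fit within pools of machines -/

/-- The load at time `t` of the past requests that satisfy `P` together with their decisions, as
computed from the record of an online rule. -/
def pastLoad {α β : Type*} (req : α → Request) (past : List (α × β)) (P : α × β → Prop)
    (t : ℝ) : ℝ :=
  open Classical in
  (past.map fun x => if P x ∧ t ∈ (req x.1).span then (req x.1).size else 0).sum

/-- The first of the machines `(p, 0), (p, 1), …` of the pool `p` that has room for the arriving
request `r`. -/
def firstFitBin {α P : Type*} (req : α → Request) (past : List (α × (P × ℕ))) (r : Request)
    (p : P) : ℕ :=
  sInf {b | pastLoad req past (fun x => x.2 = (p, b)) r.start + r.size ≤ 1}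

namespace Instance

variable (I : Instance)

lemma pastLoad_take {α β : Type*} (req : α → Request) {f : Fin I.n → α}
    (hf : ∀ j, req (f j) = I.req j) (d : Fin I.n → β) (i : Fin I.n) (P : α × β → Prop)
    (t : ℝ) :
    pastLoad req (((List.finRange I.n).take i).map fun j => (f j, d j)) P t =
      I.loadOn (fun j => j < i ∧ P (f j, d j)) t := by
  classical
  rw [pastLoad, List.map_map, sum_map_take_finRange _ _ i.2.le, loadOn_eq_sum]
  simp only [Function.comp_apply, hf, active, Finset.sum_filter]
  refine Finset.sum_congr rfl fun j _ => ?_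
  by_cases h1 : (j : ℕ) < i <;> by_cases h2 : P (f j, d j) <;> by_cases h3 : t ∈ (I.req j).span <;>
    simp [h1, h2, h3, ← Fin.val_fin_lt]

lemma feasible_of_labels {B : Type*} {lab : Fin I.n → B} {e : B → ℕ} (he : Function.Injective e)
    (h : ∀ i, I.loadOn (fun j => j < i ∧ lab j = lab i) (I.req i).start + (I.req i).size ≤ 1) :
    I.Feasible fun i => e (lab i) := by
  rw [feasible_iff]
  intro t m
  refine I.loadOn_le_of_arrivals zero_le_one (fun i hi => le_trans ?_ (h i)) t
  gcongr
  refine I.loadOn_mono fun j hj => ⟨hj.1, he (hj.2.trans hi.symm)⟩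

/-- Request `i` is put by First Fit into a machine of its pool. -/
def FirstFitAt {P : Type*} (lab : Fin I.n → P × ℕ) (i : Fin I.n) : Prop :=
  (lab i).2 = sInf {b | I.loadOn (fun j => j < i ∧ lab j = ((lab i).1, b)) (I.req i).start +
    (I.req i).size ≤ 1}

variable {I}

lemma FirstFitAt.fits {P : Type*} {lab : Fin I.n → P × ℕ} {i : Fin I.n} (h : I.FirstFitAt lab i) :
    I.loadOn (fun j => j < i ∧ lab j = lab i) (I.req i).start + (I.req i).size ≤ 1 := by
  classical
  have hne : {b | I.loadOn (fun j => j < i ∧ lab j = ((lab i).1, b)) (I.req i).start +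
      (I.req i).size ≤ 1}.Nonempty := by
    obtain ⟨b, hb⟩ := Infinite.exists_notMem_finset (Finset.univ.image fun j => (lab j).2)
    refine ⟨b, ?_⟩
    rw [Set.mem_ofPred_eq, I.loadOn_eq_zero, zero_add]
    · exact I.size_le_one i
    · rintro j - ⟨-, hj⟩
      exact hb (Finset.mem_image.2 ⟨j, Finset.mem_univ _, by rw [hj]⟩)
  have := Nat.sInf_mem hne
  rw [← h] at this
  exact this

lemma FirstFitAt.one_lt {P : Type*} {lab : Fin I.n → P × ℕ} {i : Fin I.n}
    (h : I.FirstFitAt lab i) {b : ℕ} (hb : b < (lab i).2) :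
    1 < I.loadOn (fun j => j < i ∧ lab j = ((lab i).1, b)) (I.req i).start + (I.req i).size := by
  rw [h] at hb
  have := Nat.notMem_of_lt_sInf hb
  rw [Set.mem_ofPred_eq] at this
  exact lt_of_not_ge this

lemma sum_loadOn_label_le {P : Type*} (lab : Fin I.n → P × ℕ) (i : Fin I.n) (p : P) (n : ℕ)
    (t : ℝ) :
    ∑ b ∈ Finset.range n, I.loadOn (fun j => j < i ∧ lab j = (p, b)) t ≤
      I.loadOn (fun j => j < i ∧ (lab j).1 = p ∧ (lab j).2 < n) t := by
  induction n with
  | zero => simpa using I.loadOn_nonneg _ _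
  | succ n ih =>
    rw [Finset.sum_range_succ]
    refine (add_le_add_left ih _).trans (I.loadOn_add_le ?_ ?_ ?_)
    · rintro j ⟨h1, h2, h3⟩; exact ⟨h1, h2, h3.trans (Nat.lt_succ_self n)⟩
    · rintro j ⟨h1, h2⟩; rw [h2]; exact ⟨h1, rfl, Nat.lt_succ_self n⟩
    · rintro j ⟨-, -, h3⟩ ⟨-, h2⟩; rw [h2] at h3; exact lt_irrefl _ h3

/-- All machines that First Fit skips are nearly full, so that the number of the chosen machine is
bounded in terms of the load of the pool. -/
lemma FirstFitAt.bin_mul_le {P : Type*} {lab : Fin I.n → P × ℕ} {i : Fin I.n}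
    (h : I.FirstFitAt lab i) {c : ℝ}
    (hc : ∀ b, 1 < I.loadOn (fun j => j < i ∧ lab j = ((lab i).1, b)) (I.req i).start +
      (I.req i).size → c ≤ I.loadOn (fun j => j < i ∧ lab j = ((lab i).1, b)) (I.req i).start) :
    ((lab i).2 : ℝ) * c ≤ I.loadOn (fun j => j < i ∧ (lab j).1 = (lab i).1) (I.req i).start := by
  calc ((lab i).2 : ℝ) * c = ∑ b ∈ Finset.range (lab i).2, c := by simp
    _ ≤ ∑ b ∈ Finset.range (lab i).2,
          I.loadOn (fun j => j < i ∧ lab j = ((lab i).1, b)) (I.req i).start :=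
        Finset.sum_le_sum fun b hb => hc b (h.one_lt (Finset.mem_range.1 hb))
    _ ≤ _ := (sum_loadOn_label_le lab i _ _ _).trans (I.loadOn_mono fun j hj => ⟨hj.1, hj.2.1⟩)

lemma FirstFitAt.bin_le {P : Type*} {lab : Fin I.n → P × ℕ} {i : Fin I.n}
    (h : I.FirstFitAt lab i) (hw : (I.req i).size ≤ 1 / 2) :
    ((lab i).2 : ℝ) ≤ 2 * I.loadOn (fun j => j < i ∧ (lab j).1 = (lab i).1) (I.req i).start := by
  have := h.bin_mul_le (c := 1 / 2) fun b hb => by linarith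
  linarith

/-! ### Strips of the load profile -/

/-- If each request satisfying `p` is active at some time at which the total size of the requests
satisfying `p` is at most `c`, then this size is at most `2 * c` at all times `t`: the requests with
such a witness before `t` are all active at the latest of these witnesses, and those with a witness
after `t` at the earliest of them. -/
lemma loadOn_le_two_mul {p : Fin I.n → Prop} {c : ℝ} (hc : 0 ≤ c)
    (h : ∀ i, p i → ∃ t ∈ (I.req i).span, I.loadOn p t ≤ c) (t : ℝ) :
    I.loadOn p t ≤ 2 * c := by
  classical
  have h' : ∀ i, ∃ τ, p i → i ∈ I.active τ ∧ I.loadOn p τ ≤ c := by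
    intro i
    by_cases hp : p i
    · obtain ⟨τ, h1, h2⟩ := h i hp
      exact ⟨τ, fun _ => ⟨mem_active.2 h1, h2⟩⟩
    · exact ⟨0, fun h => absurd h hp⟩
  choose τ hτ using h'
  have h1 : I.loadOn (fun i => p i ∧ τ i ≤ t) t ≤ c := by
    by_cases hne : ((I.active t).filter fun i => p i ∧ τ i ≤ t).Nonempty
    · obtain ⟨k, hk, hmax⟩ := Finset.exists_max_image _ τ hne
      rw [Finset.mem_filter] at hk
      refine le_trans (I.loadOn_le_loadOn fun i hi hp => ⟨?_, hp.1⟩) (hτ k hk.2.1).2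
      have h2 := hmax i (Finset.mem_filter.2 ⟨hi, hp⟩)
      have h3 := mem_active.1 (hτ i hp.1).1
      rw [mem_active] at hi ⊢
      exact ⟨h3.1.trans h2, hk.2.2.trans_lt hi.2⟩
    · rw [I.loadOn_eq_zero]
      · exact hc
      · exact fun i hi hp => hne ⟨i, Finset.mem_filter.2 ⟨hi, hp⟩⟩
  have h2 : I.loadOn (fun i => p i ∧ t < τ i) t ≤ c := by
    by_cases hne : ((I.active t).filter fun i => p i ∧ t < τ i).Nonempty
    · obtain ⟨k, hk, hmin⟩ := Finset.exists_min_image _ τ hne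
      rw [Finset.mem_filter] at hk
      refine le_trans (I.loadOn_le_loadOn fun i hi hp => ⟨?_, hp.1⟩) (hτ k hk.2.1).2
      have h2 := hmin i (Finset.mem_filter.2 ⟨hi, hp⟩)
      have h3 := mem_active.1 (hτ i hp.1).1
      rw [mem_active] at hi ⊢
      exact ⟨hi.1.trans hk.2.2.le, h2.trans_lt h3.2⟩
    · rw [I.loadOn_eq_zero]
      · exact hc
      · exact fun i hi hp => hne ⟨i, Finset.mem_filter.2 ⟨hi, hp⟩⟩
  have h3 := I.loadOn_le_add (p := p) (p₁ := fun i => p i ∧ τ i ≤ t)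
    (p₂ := fun i => p i ∧ t < τ i) (t := t) fun i hi =>
      (le_or_gt (τ i) t).imp (fun h => ⟨hi, h⟩) fun h => ⟨hi, h⟩
  linarith

lemma exists_loadOn_mul_eq {g : ℕ} (hg : 0 < g) (h : ∀ i, (I.req i).size = 1 / (g : ℝ))
    (p : Fin I.n → Prop) (t : ℝ) : ∃ m : ℕ, I.loadOn p t * g = m := by
  classical
  refine ⟨((I.active t).filter p).card, ?_⟩
  have : (g : ℝ) ≠ 0 := by positivity
  simp [loadOn_eq_sum, h, this]

end Instance

/-- The assignment of requests to strips. The pools are the strips `0, 1, …` (`Sum.inl`) and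
private pools (`Sum.inr`) for the requests of size greater than `τ`. A request goes to the lowest
strip `h` from which it cannot be lifted: at some time of its activity, the requests already above
strip `h` together with the new one would exceed the part of the load profile above strip `h`.
Within a strip, machines are chosen by First Fit. -/
def stripRule (τ : ℝ) (past : List ((Request × (ℝ → ℕ)) × ((ℕ ⊕ ℕ) × ℕ)))
    (x : Request × (ℝ → ℕ)) : (ℕ ⊕ ℕ) × ℕ :=
  if τ < x.1.size then (Sum.inr past.length, 0) else
    let h : ℕ := sInf {h | ∃ t ∈ x.1.span, (x.2 t : ℝ) <
      x.1.size + pastLoad Prod.fst past (fun y => ∃ h' > h, y.2.1 = Sum.inl h') t + h + 1}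
    (Sum.inl h, firstFitBin Prod.fst past x.1 (Sum.inl h))

namespace Instance

variable (I : Instance)

/-- The machines chosen by `stripRule`. -/
def stripLabel (τ : ℝ) (i : Fin I.n) : (ℕ ⊕ ℕ) × ℕ :=
  decision (stripRule τ) (fun j => (I.req j, I.forecast j)) i

/-- The requests in strips `≥ h`. -/
def InStripGE (τ : ℝ) (h : ℕ) (i : Fin I.n) : Prop := ∃ h' ≥ h, (I.stripLabel τ i).1 = Sum.inl h'

lemma forecast_eq {i : Fin I.n} {t : ℝ} (ht : t ∈ (I.req i).span) :
    I.forecast i t = I.loadVec t := by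
  rw [forecast, Set.indicator_of_mem]
  refine ⟨ht.1, ht.2.trans_le ?_⟩
  have : (I.req i).length ≤ I.maxLength :=
    le_ciSup (Set.finite_range fun i => (I.req i).length).bddAbove i
  rw [Request.length] at this
  linarith

lemma stripLabel_large {τ : ℝ} {i : Fin I.n} (hi : τ < (I.req i).size) :
    I.stripLabel τ i = (Sum.inr (i : ℕ), 0) := by
  rw [stripLabel, decision_eq, stripRule, if_pos hi]
  simp

lemma stripLabel_small {τ : ℝ} {i : Fin I.n} (hi : (I.req i).size ≤ τ) :
    I.FirstFitAt (I.stripLabel τ) i ∧ ∃ h : ℕ, (I.stripLabel τ i).1 = Sum.inl h ∧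
      h = sInf {h : ℕ | ∃ t ∈ (I.req i).span, (I.loadVec t : ℝ) <
        (I.req i).size + I.loadOn (fun j => j < i ∧ I.InStripGE τ (h + 1) j) t + h + 1} := by
  have key : I.stripLabel τ i = stripRule τ _ _ := decision_eq _ _ _
  rw [stripRule, if_neg hi.not_gt] at key
  constructor
  · rw [FirstFitAt]
    have h2 := congrArg Prod.snd key
    have h1 := congrArg Prod.fst key
    simp only at h1 h2
    rw [h2, firstFitBin]
    rw [← h1]
    congr 1
    ext b
    rw [Set.mem_ofPred_eq, I.pastLoad_take Prod.fst (fun j => rfl)]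
    rfl
  · refine ⟨_, congrArg Prod.fst key, ?_⟩
    congr 1
    ext h
    simp only [Set.mem_ofPred_eq]
    refine exists_congr fun t => and_congr_right fun ht => ?_
    rw [I.forecast_eq ht, I.pastLoad_take Prod.fst (fun j => rfl)]
    rfl

lemma size_le_of_stripLabel {τ : ℝ} {i : Fin I.n} {h : ℕ} (hi : (I.stripLabel τ i).1 = Sum.inl h) :
    (I.req i).size ≤ τ := by
  by_contra hc
  rw [I.stripLabel_large (not_le.1 hc)] at hi
  simp at hi

/-- Requests are lifted only as long as they fit below the load profile. -/
lemma lift_le {τ : ℝ} {i : Fin I.n} {h : ℕ} (hi : I.InStripGE τ (h + 1) i) {t : ℝ}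
    (ht : t ∈ (I.req i).span) :
    (I.req i).size + I.loadOn (fun j => j < i ∧ I.InStripGE τ (h + 1) j) t + h + 1 ≤
      I.loadVec t := by
  obtain ⟨h', hh', hl⟩ := hi
  obtain ⟨-, h'', hl', heq⟩ := I.stripLabel_small (I.size_le_of_stripLabel hl)
  obtain rfl : h' = h'' := by rw [hl] at hl'; exact Sum.inl.inj hl'
  have := Nat.notMem_of_lt_sInf (show h < _ from heq ▸ (show h < h' by omega))
  by_contra hc
  exact this ⟨t, ht, not_le.1 hc⟩

lemma exists_not_lift {τ : ℝ} {i : Fin I.n} {h : ℕ} (hi : (I.stripLabel τ i).1 = Sum.inl h) :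
    ∃ t ∈ (I.req i).span, (I.loadVec t : ℝ) <
      (I.req i).size + I.loadOn (fun j => j < i ∧ I.InStripGE τ (h + 1) j) t + h + 1 := by
  obtain ⟨-, h'', hl', heq⟩ := I.stripLabel_small (I.size_le_of_stripLabel hi)
  obtain rfl : h = h'' := by rw [hi] at hl'; exact Sum.inl.inj hl'
  have hne : {h : ℕ | ∃ t ∈ (I.req i).span, (I.loadVec t : ℝ) <
        (I.req i).size + I.loadOn (fun j => j < i ∧ I.InStripGE τ (h + 1) j) t + h + 1
      }.Nonempty := by
    refine ⟨I.loadVec (I.req i).start, (I.req i).start, ⟨le_rfl, I.start_lt_finish i⟩, ?_⟩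
    have := I.size_pos i
    have := I.loadOn_nonneg (fun j => j < i ∧
      I.InStripGE τ (I.loadVec (I.req i).start + 1) j) (I.req i).start
    linarith
  have := Nat.sInf_mem hne
  rwa [← heq] at this

/-- The requests in the strips `≥ h` fit into the part of the load profile above altitude `h`. -/
lemma loadOn_inStripGE_le {τ : ℝ} {h : ℕ} {t : ℝ} (hne : ∃ i ∈ I.active t, I.InStripGE τ h i) :
    I.loadOn (I.InStripGE τ h) t + h ≤ I.loadVec t := by
  cases h with
  | zero =>
    have := I.load_le_loadVec t
    have := I.loadOn_le_load (I.InStripGE τ 0) t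
    push_cast
    linarith
  | succ h =>
    obtain ⟨i, hi, hp, hmax⟩ := I.exists_last_active hne
    have h1 := I.loadOn_le_before_add hmax
    have h2 := I.lift_le hp (mem_active.1 hi)
    push_cast
    linarith

lemma strip_lt_loadVec {τ : ℝ} {i : Fin I.n} {h : ℕ} (hi : (I.stripLabel τ i).1 = Sum.inl h)
    {t : ℝ} (ht : i ∈ I.active t) : h < I.loadVec t := by
  have h1 : I.InStripGE τ h i := ⟨h, le_rfl, hi⟩
  have h2 := I.loadOn_inStripGE_le ⟨i, ht, h1⟩
  have h3 := I.sum_le_loadOn (p := I.InStripGE τ h) (t := t) (s := {i}) fun j hj => by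
    rw [Finset.mem_singleton] at hj; rw [hj]; exact ⟨ht, h1⟩
  have := I.size_pos i
  rw [Finset.sum_singleton] at h3
  have : (h : ℝ) < I.loadVec t := by linarith
  exact_mod_cast this

/-- At the time that prevents a request from being lifted, the strip of the request has
a small load. -/
lemma exists_loadOn_strip_lt {τ : ℝ} {i : Fin I.n} {h : ℕ}
    (hi : (I.stripLabel τ i).1 = Sum.inl h) :
    ∃ t ∈ (I.req i).span,
      I.loadOn (fun j => (I.stripLabel τ j).1 = Sum.inl h) t < 1 + (I.req i).size := by
  obtain ⟨t, ht, hlt⟩ := I.exists_not_lift hi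
  refine ⟨t, ht, ?_⟩
  have h1 := I.loadOn_inStripGE_le (τ := τ) (h := h) ⟨i, mem_active.2 ht, ⟨h, le_rfl, hi⟩⟩
  have h2 : I.loadOn (fun j => (I.stripLabel τ j).1 = Sum.inl h) t +
      I.loadOn (I.InStripGE τ (h + 1)) t ≤ I.loadOn (I.InStripGE τ h) t := by
    refine I.loadOn_add_le (fun j hj => ⟨h, le_rfl, hj⟩) ?_ ?_
    · rintro j ⟨h', hh', hj⟩; exact ⟨h', by omega, hj⟩
    · rintro j hj ⟨h', hh', hj'⟩
      rw [hj] at hj'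
      have := Sum.inl.inj hj'
      omega
  have h3 : I.loadOn (fun j => j < i ∧ I.InStripGE τ (h + 1) j) t ≤
      I.loadOn (I.InStripGE τ (h + 1)) t := I.loadOn_mono fun j hj => hj.2
  linarith

lemma stripLabel_fits (τ : ℝ) (i : Fin I.n) :
    I.loadOn (fun j => j < i ∧ I.stripLabel τ j = I.stripLabel τ i) (I.req i).start +
      (I.req i).size ≤ 1 := by
  rcases le_or_gt (I.req i).size τ with h | h
  · exact (I.stripLabel_small h).1.fits
  · rw [I.loadOn_eq_zero, zero_add]
    · exact I.size_le_one i
    · rintro j - ⟨hlt, hj⟩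
      rw [I.stripLabel_large h] at hj
      rcases le_or_gt (I.req j).size τ with h' | h'
      · obtain ⟨-, h2, h3, -⟩ := I.stripLabel_small h'
        rw [hj] at h3
        simp at h3
      · rw [I.stripLabel_large h'] at hj
        simp only [Prod.mk.injEq, Sum.inr.injEq, and_true] at hj
        exact hlt.ne (Fin.ext hj)

lemma card_stripLabel_le {τ : ℝ} {M : ℕ}
    (hM : ∀ i, (I.req i).size ≤ τ → (I.stripLabel τ i).2 < M) (t : ℝ) :
    (I.activeLabels (I.stripLabel τ) t).card ≤
      M * I.loadVec t + ((I.active t).filter fun i => τ < (I.req i).size).card := by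
  classical
  have : I.activeLabels (I.stripLabel τ) t ⊆
      ((Finset.range M ×ˢ Finset.range (I.loadVec t)).image fun x => (Sum.inl x.2, x.1)) ∪
      ((I.active t).filter fun i => τ < (I.req i).size).image fun i : Fin I.n =>
        ((Sum.inr (i : ℕ), 0) : (ℕ ⊕ ℕ) × ℕ) := by
    intro b hb
    obtain ⟨i, hi, rfl⟩ := mem_activeLabels.1 hb
    rw [Finset.mem_union, Finset.mem_image, Finset.mem_image]
    rcases le_or_gt (I.req i).size τ with h | h
    · obtain ⟨-, h', hl, -⟩ := I.stripLabel_small h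
      refine Or.inl ⟨((I.stripLabel τ i).2, h'), ?_, Prod.ext hl.symm rfl⟩
      rw [Finset.mem_product, Finset.mem_range, Finset.mem_range]
      exact ⟨hM i h, I.strip_lt_loadVec hl hi⟩
    · exact Or.inr ⟨i, Finset.mem_filter.2 ⟨hi, h⟩, (I.stripLabel_large h).symm⟩
  refine (Finset.card_le_card this).trans ((Finset.card_union_le _ _).trans ?_)
  refine add_le_add (Finset.card_image_le.trans ?_) Finset.card_image_le
  simp

lemma stripLabel_bin_lt (i : Fin I.n) (hi : (I.req i).size ≤ 1 / 2) :
    (I.stripLabel (1 / 2) i).2 < 6 := by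
  obtain ⟨hff, h, hl, -⟩ := I.stripLabel_small hi
  -- The strip never has load above `3`, and each skipped machine is at least half full.
  have hload : I.loadOn (fun j => (I.stripLabel (1 / 2) j).1 = Sum.inl h) (I.req i).start ≤
      2 * (3 / 2) := by
    refine loadOn_le_two_mul (by norm_num) (fun j hj => ?_) _
    obtain ⟨t, ht, hlt⟩ := I.exists_loadOn_strip_lt hj
    exact ⟨t, ht, by linarith [I.size_le_of_stripLabel hj]⟩
  have h1 := I.loadOn_add_le (p := fun j => (I.stripLabel (1 / 2) j).1 = Sum.inl h)
    (p₁ := fun j => j < i ∧ (I.stripLabel (1 / 2) j).1 = (I.stripLabel (1 / 2) i).1)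
    (p₂ := fun j => j = i) (t := (I.req i).start) (fun j hj => hj.2.trans hl)
    (fun j hj => hj ▸ hl) fun j hj => hj.1.ne
  have h2 := I.sum_le_loadOn (p := fun j => j = i) (t := (I.req i).start) (s := {i}) fun j hj => by
    rw [Finset.mem_singleton] at hj; rw [hj]
    exact ⟨mem_active.2 ⟨le_rfl, I.start_lt_finish i⟩, rfl⟩
  rw [Finset.sum_singleton] at h2
  have h3 := hff.bin_le hi
  have h4 := I.size_pos i
  have : ((I.stripLabel (1 / 2) i).2 : ℝ) < (6 : ℕ) := by push_cast; linarith
  exact_mod_cast this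

lemma stripLabel_bin_lt_of_uniform (hI : I.Uniform) (i : Fin I.n) :
    (I.stripLabel 1 i).2 < 2 := by
  obtain ⟨g, hg, hw⟩ := hI
  have hg' : (0 : ℝ) < g := by positivity
  obtain ⟨hff, h, hl, -⟩ := I.stripLabel_small (I.size_le_one i)
  have hload : I.loadOn (fun j => (I.stripLabel 1 j).1 = Sum.inl h) (I.req i).start ≤ 2 * 1 := by
    refine loadOn_le_two_mul zero_le_one (fun j hj => ?_) _
    obtain ⟨t, ht, hlt⟩ := I.exists_loadOn_strip_lt hj
    refine ⟨t, ht, ?_⟩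
    -- The load is a multiple of `1 / g` below `1 + 1 / g`.
    obtain ⟨m, hm⟩ := exists_loadOn_mul_eq hg hw
      (fun j => (I.stripLabel 1 j).1 = Sum.inl h) t
    rw [hw, ← mul_lt_mul_iff_left₀ hg', hm, add_mul, one_mul, div_mul_cancel₀ _ hg'.ne'] at hlt
    have : m ≤ g := Nat.lt_succ_iff.1 (by exact_mod_cast hlt)
    rw [← mul_le_mul_iff_left₀ hg', hm, one_mul]
    exact_mod_cast this
  have h1 := I.loadOn_add_le (p := fun j => (I.stripLabel 1 j).1 = Sum.inl h)
    (p₁ := fun j => j < i ∧ (I.stripLabel 1 j).1 = (I.stripLabel 1 i).1)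
    (p₂ := fun j => j = i) (t := (I.req i).start) (fun j hj => hj.2.trans hl)
    (fun j hj => hj ▸ hl) fun j hj => hj.1.ne
  have h2 := I.sum_le_loadOn (p := fun j => j = i) (t := (I.req i).start) (s := {i}) fun j hj => by
    rw [Finset.mem_singleton] at hj; rw [hj]
    exact ⟨mem_active.2 ⟨le_rfl, I.start_lt_finish i⟩, rfl⟩
  rw [Finset.sum_singleton] at h2
  have h3 := hff.bin_mul_le (c := 1) fun b hb => by
    obtain ⟨m, hm⟩ := exists_loadOn_mul_eq hg hw
      (fun j => j < i ∧ I.stripLabel 1 j = ((I.stripLabel 1 i).1, b)) (I.req i).start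
    rw [hw, ← mul_lt_mul_iff_left₀ hg', add_mul, hm, one_mul, div_mul_cancel₀ _ hg'.ne'] at hb
    have : g ≤ m := Nat.lt_succ_iff.1 (by exact_mod_cast hb)
    rw [← mul_le_mul_iff_left₀ hg', hm, one_mul]
    exact_mod_cast this
  have h4 := I.size_pos i
  have : ((I.stripLabel 1 i).2 : ℝ) < (2 : ℕ) := by push_cast; linarith
  exact_mod_cast this

end Instance

/-- The online algorithm that follows `stripRule τ`. -/
def stripAlgorithm (τ : ℝ) : LoadVectorAlgorithm :=
  fun l => Encodable.encode (lastDecision (stripRule τ) l)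

lemma stripAlgorithm_run (τ : ℝ) (I : Instance) :
    (stripAlgorithm τ).run I = fun i => Encodable.encode (I.stripLabel τ i) := by
  ext i
  simp only [LoadVectorAlgorithm.run, stripAlgorithm, Instance.stripLabel]
  rw [lastDecision_take]

lemma stripAlgorithm_feasible (τ : ℝ) (I : Instance) : I.Feasible ((stripAlgorithm τ).run I) := by
  rw [stripAlgorithm_run]
  exact I.feasible_of_labels Encodable.encode_injective (I.stripLabel_fits τ)

lemma stripAlgorithm_half_le (I : Instance) :
    I.avgCost ((stripAlgorithm (1 / 2)).run I) ≤ 8 * I.optAvg := by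
  rw [Instance.avgCost, Instance.optAvg, ← mul_div_assoc]
  refine div_le_div_of_nonneg_right ?_ I.horizon_pos.le
  rw [← add_zero (8 * I.opt)]
  refine I.le_mul_opt_add (by norm_num) fun σ hσ => ?_
  rw [stripAlgorithm_run, I.cost_eq_integral _ _ Encodable.encode_injective,
    I.cost_eq_integral_self, add_zero, ← integral_const_mul]
  refine integral_mono (I.integrable_card_activeLabels _)
    ((I.integrable_card_activeLabels _).const_mul _) fun t => ?_
  have h1 := I.card_stripLabel_le I.stripLabel_bin_lt t
  have h2 := I.card_large_le_card hσ t _ (Finset.filter_subset (fun i => 1 / 2 < (I.req i).size) _)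
    fun i hi => (Finset.mem_filter.1 hi).2
  have h3 := I.loadVec_le_card hσ t
  have : (I.activeLabels (I.stripLabel (1 / 2)) t).card ≤ 8 * (I.activeLabels σ t).card := by
    omega
  beta_reduce
  exact_mod_cast this

lemma stripAlgorithm_one_le (I : Instance) (hI : I.Uniform) :
    I.avgCost ((stripAlgorithm 1).run I) ≤ 2 * I.optAvg := by
  rw [Instance.avgCost, Instance.optAvg, ← mul_div_assoc]
  refine div_le_div_of_nonneg_right ?_ I.horizon_pos.le
  rw [← add_zero (2 * I.opt)]
  refine I.le_mul_opt_add (by norm_num) fun σ hσ => ?_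
  rw [stripAlgorithm_run, I.cost_eq_integral _ _ Encodable.encode_injective,
    I.cost_eq_integral_self, add_zero, ← integral_const_mul]
  refine integral_mono (I.integrable_card_activeLabels _)
    ((I.integrable_card_activeLabels _).const_mul _) fun t => ?_
  have h1 := I.card_stripLabel_le (fun i _ => I.stripLabel_bin_lt_of_uniform hI i) t
  have h2 : ((I.active t).filter fun i => 1 < (I.req i).size) = ∅ :=
    Finset.filter_false_of_mem fun i _ => (I.size_le_one i).not_gt
  have h3 := I.loadVec_le_card hσ t
  rw [h2, Finset.card_empty] at h1
  have : (I.activeLabels (I.stripLabel 1) t).card ≤ 2 * (I.activeLabels σ t).card := by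
    omega
  beta_reduce
  exact_mod_cast this

/-! ### Next-Fit -/

lemma foldl_nextFitStep_concat (L : List ℝ) (w : ℝ) :
    (L ++ [w]).foldl nextFitStep (0, 0) = nextFitStep (L.foldl nextFitStep (0, 0)) w := by
  simp

lemma one_le_nextFitBins {L : List ℝ} (hL : L ≠ []) : 1 ≤ nextFitBins L := by
  induction L using List.reverseRecOn with
  | nil => exact absurd rfl hL
  | append_singleton L w _ =>
    rw [nextFitBins, foldl_nextFitStep_concat, nextFitStep]
    split_ifs with h
    · exact Nat.one_le_iff_ne_zero.2 h.1
    · simp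

/-- The bins before the active one and the level of the active one are paid for by twice the total
size, since consecutive bins together are fuller than `1`. -/
lemma nextFit_potential_le {L : List ℝ} (hL : ∀ w ∈ L, 0 < w) (hne : L ≠ []) :
    ((L.foldl nextFitStep (0, 0)).1 : ℝ) - 1 + (L.foldl nextFitStep (0, 0)).2 ≤ 2 * L.sum := by
  induction L using List.reverseRecOn with
  | nil => exact absurd rfl hne
  | append_singleton L w ih =>
    have hw : 0 < w := hL w (by simp)
    rw [foldl_nextFitStep_concat, List.sum_append, List.sum_singleton]
    rcases eq_or_ne L [] with rfl | hL'
    · simp [nextFitStep]; linarith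
    · have h1 := one_le_nextFitBins hL'
      have h2 := ih (fun x hx => hL x (by simp [hx])) hL'
      rw [nextFitBins] at h1
      rw [nextFitStep]
      split_ifs with h
      · simp only; linarith
      · have h3 : 1 < (L.foldl nextFitStep (0, 0)).2 + w := by
          by_contra hc
          exact h ⟨by omega, not_lt.1 hc⟩
        push_cast
        linarith

lemma nextFit_level_nonneg {L : List ℝ} (hL : ∀ w ∈ L, 0 < w) :
    0 ≤ (L.foldl nextFitStep (0, 0)).2 := by
  induction L using List.reverseRecOn with
  | nil => simp
  | append_singleton L w ih =>
    have hw : 0 < w := hL w (by simp)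
    have h2 := ih fun x hx => hL x (by simp [hx])
    rw [foldl_nextFitStep_concat, nextFitStep]
    split_ifs
    · simp only; linarith
    · exact hw.le

lemma nextFitBins_le {L : List ℝ} (hL : ∀ w ∈ L, 0 < w) :
    (nextFitBins L : ℝ) ≤ 2 * L.sum + 1 := by
  rcases eq_or_ne L [] with rfl | hne
  · simp [nextFitBins]
  · have h1 := nextFit_potential_le hL hne
    have h2 := nextFit_level_nonneg hL
    rw [nextFitBins]
    linarith

/-- For items of the common size `1 / g`, Next-Fit fills its bins completely. -/
lemma nextFitBins_le_of_uniform {g : ℕ} (hg : 0 < g) {L : List ℝ}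
    (hL : ∀ w ∈ L, w = 1 / (g : ℝ)) : (nextFitBins L : ℝ) ≤ L.sum + 1 := by
  have hg' : (0 : ℝ) < g := by positivity
  have key : (∃ a : ℕ, (L.foldl nextFitStep (0, 0)).2 * g = a) ∧ (L ≠ [] →
      ((L.foldl nextFitStep (0, 0)).1 : ℝ) - 1 + (L.foldl nextFitStep (0, 0)).2 ≤ L.sum) := by
    induction L using List.reverseRecOn with
    | nil => exact ⟨⟨0, by simp⟩, fun h => absurd rfl h⟩
    | append_singleton L w ih =>
      have hw : w = 1 / (g : ℝ) := hL w (by simp)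
      obtain ⟨⟨a, ha⟩, h2⟩ := ih fun x hx => hL x (by simp [hx])
      rw [foldl_nextFitStep_concat, List.sum_append, List.sum_singleton, nextFitStep]
      split_ifs with h
      · refine ⟨⟨a + 1, ?_⟩, fun _ => ?_⟩
        · simp only [add_mul, ha, hw, div_mul_cancel₀ _ hg'.ne']; push_cast; ring
        · have hL' : L ≠ [] := by rintro rfl; simp at h
          have := h2 hL'
          simp only; linarith
      · refine ⟨⟨1, ?_⟩, fun _ => ?_⟩
        · simp only [hw, div_mul_cancel₀ _ hg'.ne', Nat.cast_one]
        · rcases eq_or_ne L [] with rfl | hL'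
          · simp
          · have h1 := one_le_nextFitBins hL'
            rw [nextFitBins] at h1
            have h3 : 1 < (L.foldl nextFitStep (0, 0)).2 + w := by
              by_contra hc
              exact h ⟨by omega, not_lt.1 hc⟩
            have h4 : 1 ≤ (L.foldl nextFitStep (0, 0)).2 := by
              rw [hw, ← mul_lt_mul_iff_left₀ hg', add_mul, ha, one_mul,
                div_mul_cancel₀ _ hg'.ne'] at h3
              have : g ≤ a := Nat.lt_succ_iff.1 (by exact_mod_cast h3)
              rw [← mul_le_mul_iff_left₀ hg', ha, one_mul]
              exact_mod_cast this
            have := h2 hL'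
            push_cast
            linarith
  rcases eq_or_ne L [] with rfl | hne
  · simp [nextFitBins]
  · have h1 := key.2 hne
    have h2 := nextFit_level_nonneg (L := L) fun w hw => by rw [hL w hw]; positivity
    rw [nextFitBins]
    linarith

/-- Next-Fit started with `m + 1` bins is never more than one bin better on the remaining items
than Next-Fit started afresh. -/
lemma nextFit_foldl_mono {L : List ℝ} (hL : ∀ w ∈ L, 0 < w) (m : ℕ) :
    ∀ s s' : ℕ × ℝ, 0 ≤ s'.2 →
      (s.1 + m < s'.1 ∨ (s.1 ≠ 0 ∧ s.1 + m = s'.1 ∧ s.2 ≤ s'.2)) →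
      (L.foldl nextFitStep s).1 + m ≤ (L.foldl nextFitStep s').1 := by
  induction L with
  | nil => rintro s s' - (h | h) <;> simp <;> omega
  | cons w L ih =>
    intro s s' hs' h
    have hw : 0 < w := hL w (by simp)
    rw [List.foldl_cons, List.foldl_cons]
    refine ih (fun x hx => hL x (by simp [hx])) _ _ ?_ ?_
    · rw [nextFitStep]
      split_ifs
      · simp only; linarith
      · exact hw.le
    · rcases h with h | ⟨h0, h1, h2⟩
      · rw [nextFitStep, nextFitStep]
        split_ifs with c1 c2 c2 <;> simp only
        · exact Or.inl h
        · exact Or.inl (by omega)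
        · rcases Nat.lt_or_ge (s.1 + 1 + m) s'.1 with h3 | h3
          · exact Or.inl h3
          · exact Or.inr ⟨by omega, by omega, by linarith⟩
        · exact Or.inl (by omega)
      · have c0 : s'.1 ≠ 0 := by omega
        by_cases c2 : s'.2 + w ≤ 1
        · have c1 : s.2 + w ≤ 1 := by linarith
          rw [nextFitStep, nextFitStep, if_pos ⟨h0, c1⟩, if_pos ⟨c0, c2⟩]
          exact Or.inr ⟨h0, h1, by linarith⟩
        · rw [nextFitStep, nextFitStep,
            if_neg (show ¬ (s'.1 ≠ 0 ∧ s'.2 + w ≤ 1) from fun h => c2 h.2)]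
          split_ifs <;> simp only
          · exact Or.inl (by omega)
          · exact Or.inr ⟨by omega, by omega, le_rfl⟩

lemma nextFitBins_add_le {L₁ L₂ : List ℝ} (h₁ : ∀ w ∈ L₁, 0 < w) (h₂ : ∀ w ∈ L₂, 0 < w) :
    nextFitBins L₁ + nextFitBins L₂ ≤ nextFitBins (L₁ ++ L₂) + 1 := by
  rcases eq_or_ne L₁ [] with rfl | hne
  · simp [nextFitBins]
  · have h1 := one_le_nextFitBins hne
    have := nextFit_foldl_mono h₂ (nextFitBins L₁ - 1) (0, 0) (L₁.foldl nextFitStep (0, 0))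
      (nextFit_level_nonneg h₁) (Or.inl (by rw [← nextFitBins]; simp; omega))
    rw [← List.foldl_append, ← nextFitBins, ← nextFitBins] at this
    omega

lemma nextFitStep_fst_mono (s : ℕ × ℝ) (w : ℝ) : s.1 ≤ (nextFitStep s w).1 := by
  rw [nextFitStep]; split_ifs <;> simp

lemma nextFitBins_prefix {L₁ L₂ : List ℝ} (h : L₁ <+: L₂) : nextFitBins L₁ ≤ nextFitBins L₂ := by
  obtain ⟨L, rfl⟩ := h
  induction L using List.reverseRecOn with
  | nil => simp
  | append_singleton L w ih =>
    refine ih.trans ?_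
    rw [nextFitBins, nextFitBins, ← List.append_assoc, foldl_nextFitStep_concat]
    exact nextFitStep_fst_mono _ _

/-! ### The optimal static packing -/

lemma sum_get_eq (L : List ℝ) {m : ℕ} (b : Fin L.length → Fin m) (b' : ℕ → ℕ)
    (hb : ∀ i : Fin L.length, b' i = b i) (c : Fin m) :
    ∑ i with b i = c, L.get i =
      ∑ i ∈ Finset.range L.length, if b' i = c then L.getD i 0 else 0 := by
  rw [← Fin.sum_univ_eq_sum_range (fun i => if b' i = c then L.getD i 0 else 0), Finset.sum_filter]
  refine Finset.sum_congr rfl fun i _ => ?_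
  simp [hb, Fin.ext_iff]

lemma staticOpt_le {L : List ℝ} {m : ℕ} (b : ℕ → ℕ) (hb : ∀ i < L.length, b i < m)
    (h : ∀ c, ∑ i ∈ Finset.range L.length, (if b i = c then L.getD i 0 else 0) ≤ 1) :
    staticOpt L ≤ m := by
  refine Nat.sInf_le ⟨fun i => ⟨b i, hb i i.2⟩, fun c => ?_⟩
  rw [sum_get_eq L _ b fun i => rfl]
  exact h c

lemma exists_packing {L : List ℝ} (hL : ValidItems L) :
    ∃ b : ℕ → ℕ, (∀ i < L.length, b i < staticOpt L) ∧
      ∀ c, ∑ i ∈ Finset.range L.length, (if b i = c then L.getD i 0 else 0) ≤ 1 := by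
  have hne : {m : ℕ | ∃ b : Fin L.length → Fin m, ∀ c : Fin m,
      ∑ i with b i = c, L.get i ≤ 1}.Nonempty := by
    refine ⟨L.length, id, fun c => ?_⟩
    simp only [id, Finset.filter_eq', Finset.mem_univ, if_true, Finset.sum_singleton]
    exact (hL _ (List.get_mem _ _)).2
  obtain ⟨b, hb⟩ := Nat.sInf_mem hne
  refine ⟨fun i => if h : i < L.length then b ⟨i, h⟩ else 0, fun i hi => ?_, fun c => ?_⟩
  · beta_reduce
    rw [dif_pos hi]; exact (b ⟨i, hi⟩).2
  · by_cases hc : c < staticOpt L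
    · refine le_of_eq_of_le ?_ (hb ⟨c, hc⟩)
      rw [sum_get_eq L b (fun i => if h : i < L.length then b ⟨i, h⟩ else 0) (by simp)]
    · rw [Finset.sum_eq_zero]
      · exact zero_le_one
      · intro i hi
        rw [Finset.mem_range] at hi
        beta_reduce
        rw [dif_pos hi, if_neg]
        have : (b ⟨i, hi⟩ : ℕ) < staticOpt L := (b ⟨i, hi⟩).2
        omega

lemma staticOpt_append_le {L₁ L₂ : List ℝ} (h₁ : ValidItems L₁) (h₂ : ValidItems L₂) :
    staticOpt (L₁ ++ L₂) ≤ staticOpt L₁ + staticOpt L₂ := by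
  obtain ⟨b₁, hb₁, hs₁⟩ := exists_packing h₁
  obtain ⟨b₂, hb₂, hs₂⟩ := exists_packing h₂
  refine staticOpt_le (fun i => if i < L₁.length then b₁ i else staticOpt L₁ + b₂ (i - L₁.length))
    (fun i hi => ?_) fun c => ?_
  · rw [List.length_append] at hi
    split_ifs with h
    · exact (hb₁ i h).trans_le (Nat.le_add_right _ _)
    · exact Nat.add_lt_add_left (hb₂ _ (by omega)) _
  · rw [List.length_append, Finset.sum_range_add]
    rcases Nat.lt_or_ge c (staticOpt L₁) with hc | hc
    · have e1 : ∑ x ∈ Finset.range L₂.length, (if (if L₁.length + x < L₁.length then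
          b₁ (L₁.length + x) else staticOpt L₁ + b₂ (L₁.length + x - L₁.length)) = c then
          (L₁ ++ L₂).getD (L₁.length + x) 0 else 0) = 0 := by
        refine Finset.sum_eq_zero fun x hx => ?_
        rw [if_neg (by omega : ¬ L₁.length + x < L₁.length), if_neg (by omega)]
      rw [e1, add_zero]
      refine le_of_eq_of_le (Finset.sum_congr rfl fun x hx => ?_) (hs₁ c)
      rw [Finset.mem_range] at hx
      rw [if_pos hx, List.getD_append _ _ _ _ hx]
    · have e1 : ∑ x ∈ Finset.range L₁.length, (if (if x < L₁.length then
          b₁ x else staticOpt L₁ + b₂ (x - L₁.length)) = c then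
          (L₁ ++ L₂).getD x 0 else 0) = 0 := by
        refine Finset.sum_eq_zero fun x hx => ?_
        rw [Finset.mem_range] at hx
        have := hb₁ x hx
        rw [if_pos hx, if_neg (by omega)]
      rw [e1, zero_add]
      refine le_of_eq_of_le (Finset.sum_congr rfl fun x hx => ?_) (hs₂ (c - staticOpt L₁))
      rw [if_neg (by omega : ¬ L₁.length + x < L₁.length),
        List.getD_append_right _ _ _ _ (by omega), Nat.add_sub_cancel_left]
      refine if_congr (by omega) rfl rfl

lemma sum_le_staticOpt {L : List ℝ} (hL : ValidItems L) : L.sum ≤ staticOpt L := by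
  obtain ⟨b, hb, hs⟩ := exists_packing hL
  have h1 : L.sum = ∑ i ∈ Finset.range L.length, L.getD i 0 := by
    rw [← Fin.sum_univ_eq_sum_range (fun i => L.getD i 0)]
    simp
  rw [h1]
  calc _ = ∑ i ∈ Finset.range L.length, ∑ c ∈ Finset.range (staticOpt L),
          (if b i = c then L.getD i 0 else 0) := by
        refine Finset.sum_congr rfl fun i hi => ?_
        rw [Finset.sum_ite_eq, if_pos (Finset.mem_range.2 (hb i (Finset.mem_range.1 hi)))]
    _ = ∑ c ∈ Finset.range (staticOpt L), ∑ i ∈ Finset.range L.length,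
          (if b i = c then L.getD i 0 else 0) := Finset.sum_comm
    _ ≤ ∑ c ∈ Finset.range (staticOpt L), (1 : ℝ) := Finset.sum_le_sum fun c _ => hs c
    _ = _ := by simp

/-! ### The asymptotic ratio of Harmonic -/

lemma harmonicClass_append (k j : ℕ) (L₁ L₂ : List ℝ) :
    harmonicClass k j (L₁ ++ L₂) = harmonicClass k j L₁ ++ harmonicClass k j L₂ :=
  List.filter_append _ _

lemma ValidItems.harmonicClass_pos {L : List ℝ} (hL : ValidItems L) (k j : ℕ) :
    ∀ w ∈ harmonicClass k j L, 0 < w := fun w hw => (hL w (List.mem_of_mem_filter hw)).1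

lemma harmonicBins_add_le (k : ℕ) {L₁ L₂ : List ℝ} (h₁ : ValidItems L₁) (h₂ : ValidItems L₂) :
    harmonicBins k L₁ + harmonicBins k L₂ ≤ harmonicBins k (L₁ ++ L₂) + k := by
  calc _ = ∑ j ∈ Finset.Icc 1 k,
          (nextFitBins (harmonicClass k j L₁) + nextFitBins (harmonicClass k j L₂)) :=
        Finset.sum_add_distrib.symm
    _ ≤ ∑ j ∈ Finset.Icc 1 k, (nextFitBins (harmonicClass k j (L₁ ++ L₂)) + 1) := by
        refine Finset.sum_le_sum fun j _ => ?_
        rw [harmonicClass_append]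
        exact nextFitBins_add_le (h₁.harmonicClass_pos k j) (h₂.harmonicClass_pos k j)
    _ = _ := by simp [Finset.sum_add_distrib, harmonicBins]

/-- The harmonic class of an item of size `w`. -/
def harmonicIndex (k : ℕ) (w : ℝ) : ℕ := min k ⌊1 / w⌋₊

lemma harmonicIndex_mem {k : ℕ} (hk : 1 ≤ k) {w : ℝ} (h0 : 0 < w) (h1 : w ≤ 1) :
    harmonicIndex k w ∈ Finset.Icc 1 k := by
  rw [Finset.mem_Icc, harmonicIndex]
  refine ⟨le_min hk ?_, min_le_left _ _⟩
  rw [Nat.one_le_floor_iff, le_div_iff₀ h0]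
  linarith

lemma mem_harmonicClass_iff {k j : ℕ} (hj : j ∈ Finset.Icc 1 k) {w : ℝ} (h0 : 0 < w) :
    ((j = k ∨ 1 / ((j : ℝ) + 1) < w) ∧ w ≤ 1 / (j : ℝ)) ↔ j = harmonicIndex k w := by
  rw [Finset.mem_Icc] at hj
  have hj0 : (0 : ℝ) < j := by exact_mod_cast hj.1
  have e1 : w ≤ 1 / (j : ℝ) ↔ j ≤ ⌊1 / w⌋₊ := by
    rw [Nat.le_floor_iff (by positivity), le_div_iff₀ hj0, le_div_iff₀ h0, mul_comm]
  have e2 : 1 / ((j : ℝ) + 1) < w ↔ ⌊1 / w⌋₊ < j + 1 := by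
    rw [Nat.floor_lt (by positivity), div_lt_iff₀ (by positivity), div_lt_iff₀ h0, mul_comm]
    push_cast
    rfl
  rw [e1, e2, harmonicIndex]
  omega

/-- Items that are packed by Next-Fit in groups, each within one harmonic class, take no more bins
than Harmonic uses on all of them together, up to one bin per group. -/
lemma sum_nextFitBins_le (k : ℕ) (gs : List (List ℝ)) (hv : ∀ g ∈ gs, ValidItems g)
    (hc : ∀ g ∈ gs, ∃ c ∈ Finset.Icc 1 k, ∀ w ∈ g, harmonicIndex k w = c) :
    (gs.map nextFitBins).sum ≤ harmonicBins k gs.flatten + gs.length := by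
  induction gs with
  | nil => simp
  | cons g gs ih =>
    have ih' := ih (fun g hg => hv g (by simp [hg])) fun g hg => hc g (by simp [hg])
    obtain ⟨c, hck, hcg⟩ := hc g (by simp)
    have hvg := hv g (by simp)
    have hvr : ValidItems gs.flatten := by
      intro w hw
      obtain ⟨g', hg', hw'⟩ := List.mem_flatten.1 hw
      exact hv g' (by simp [hg']) w hw'
    have key : nextFitBins g + harmonicBins k gs.flatten ≤
        harmonicBins k (g ++ gs.flatten) + 1 := by
      rw [harmonicBins, harmonicBins, ← Finset.add_sum_erase _ _ hck,
        ← Finset.add_sum_erase _ _ hck]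
      have e1 : ∀ j ∈ (Finset.Icc 1 k).erase c, nextFitBins (harmonicClass k j (g ++ gs.flatten)) =
          nextFitBins (harmonicClass k j gs.flatten) := by
        intro j hj
        rw [Finset.mem_erase] at hj
        have : harmonicClass k j g = [] := by
          rw [harmonicClass, List.filter_eq_nil_iff]
          intro w hw
          rw [decide_eq_true_eq, mem_harmonicClass_iff hj.2 (hvg w hw).1, hcg w hw]
          exact hj.1
        rw [harmonicClass_append, this, List.nil_append]
      have e2 : harmonicClass k c g = g := by
        rw [harmonicClass, List.filter_eq_self]
        intro w hw
        rw [decide_eq_true_eq, mem_harmonicClass_iff hck (hvg w hw).1, hcg w hw]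
      have := nextFitBins_add_le (fun w hw => (hvg w hw).1) (hvr.harmonicClass_pos k c)
      rw [Finset.sum_congr rfl e1, harmonicClass_append, e2]
      omega
    simp only [List.map_cons, List.sum_cons, List.flatten_cons, List.length_cons]
    omega

lemma ValidItems.replicate {L : List ℝ} (hL : ValidItems L) (N : ℕ) :
    ValidItems (List.replicate N L).flatten := by
  intro w hw
  obtain ⟨g, hg, hw'⟩ := List.mem_flatten.1 hw
  exact hL w (List.eq_of_mem_replicate hg ▸ hw')

lemma harmonicBins_replicate (k : ℕ) {L : List ℝ} (hL : ValidItems L) (N : ℕ) :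
    N * harmonicBins k L ≤ harmonicBins k (List.replicate N L).flatten + N * k := by
  induction N with
  | zero => simp
  | succ N ih =>
    have := harmonicBins_add_le k hL (hL.replicate N)
    rw [List.replicate_succ, List.flatten_cons, add_mul, add_mul]
    omega

lemma staticOpt_replicate {L : List ℝ} (hL : ValidItems L) (N : ℕ) :
    staticOpt (List.replicate N L).flatten ≤ N * staticOpt L := by
  induction N with
  | zero => exact staticOpt_le id (by simp) (by simp)
  | succ N ih =>
    have := staticOpt_append_le hL (hL.replicate N)
    rw [List.replicate_succ, List.flatten_cons, add_mul]
    omega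

lemma harmonicRatio_set_nonneg {k : ℕ} {c : ℝ} (hc : ∃ l : ℝ, ∀ L : List ℝ, ValidItems L →
    (harmonicBins k L : ℝ) ≤ c * (staticOpt L : ℝ) + l) : 0 ≤ c := by
  obtain ⟨l, hl⟩ := hc
  by_contra hneg
  rw [not_le] at hneg
  obtain ⟨N, hN⟩ := exists_nat_gt (l / (-c))
  have hv : ValidItems (List.replicate N 1) := by
    intro w hw
    rw [List.eq_of_mem_replicate hw]
    norm_num
  have h1 := hl _ hv
  have h2 := sum_le_staticOpt hv
  rw [List.sum_replicate, nsmul_eq_mul, mul_one] at h2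
  rw [div_lt_iff₀ (by linarith)] at hN
  have h3 : (0 : ℝ) ≤ harmonicBins k (List.replicate N 1) := Nat.cast_nonneg _
  nlinarith

lemma harmonicRatio_nonneg (k : ℕ) : 0 ≤ harmonicRatio k :=
  Real.sInf_nonneg fun _ hc => harmonicRatio_set_nonneg hc

lemma sum_harmonicClass_le {k : ℕ} {L : List ℝ} (hL : ValidItems L) :
    ∑ j ∈ Finset.Icc 1 k, (harmonicClass k j L).sum ≤ L.sum := by
  induction L with
  | nil => simp [harmonicClass]
  | cons w L ih =>
    have hw := hL w (by simp)
    have ih' := ih fun x hx => hL x (by simp [hx])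
    have e : ∀ j ∈ Finset.Icc 1 k, (harmonicClass k j (w :: L)).sum =
        (if j = harmonicIndex k w then w else 0) + (harmonicClass k j L).sum := by
      intro j hj
      have := mem_harmonicClass_iff hj hw.1
      rw [harmonicClass, List.filter_cons]
      simp only [decide_eq_true_eq, this]
      split_ifs <;> simp [harmonicClass]
    rw [Finset.sum_congr rfl e, Finset.sum_add_distrib, List.sum_cons, Finset.sum_ite_eq']
    have : (if harmonicIndex k w ∈ Finset.Icc 1 k then w else 0) ≤ w := by
      split_ifs
      · exact le_rfl
      · exact hw.1.le
    linarith

/-- The additive constant in the definition of `harmonicRatio` can be taken to be `k`, even for the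
ratio itself: apply the definition to many copies of the list. -/
lemma harmonicBins_le (k : ℕ) {L : List ℝ} (hL : ValidItems L) :
    (harmonicBins k L : ℝ) ≤ harmonicRatio k * staticOpt L + k := by
  have key : ∀ c ∈ {c : ℝ | ∃ l : ℝ, ∀ L : List ℝ, ValidItems L →
      (harmonicBins k L : ℝ) ≤ c * (staticOpt L : ℝ) + l},
      (harmonicBins k L : ℝ) - k ≤ c * staticOpt L := by
    intro c hc
    have hc0 := harmonicRatio_set_nonneg hc
    obtain ⟨l, hl⟩ := hc
    by_contra hlt
    rw [not_le] at hlt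
    obtain ⟨N, hN⟩ := exists_nat_gt (l / ((harmonicBins k L : ℝ) - k - c * staticOpt L))
    rw [div_lt_iff₀ (by linarith)] at hN
    have h1 := hl _ (hL.replicate N)
    have h2 : (N : ℝ) * harmonicBins k L ≤
        harmonicBins k (List.replicate N L).flatten + N * k := by
      exact_mod_cast harmonicBins_replicate k hL N
    have h3 : (staticOpt (List.replicate N L).flatten : ℝ) ≤ N * staticOpt L := by
      exact_mod_cast staticOpt_replicate hL N
    have h4 := mul_le_mul_of_nonneg_left h3 hc0
    linarith
  rcases Nat.eq_zero_or_pos (staticOpt L) with h0 | hpos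
  · rw [h0]
    have hsum := sum_le_staticOpt hL
    rw [h0, Nat.cast_zero] at hsum
    have : L = [] := by
      cases L with
      | nil => rfl
      | cons w L =>
        have h1 := (hL w (by simp)).1
        have h2 : 0 ≤ L.sum := List.sum_nonneg fun x hx => (hL x (by simp [hx])).1.le
        rw [List.sum_cons] at hsum
        linarith
    simp [this, harmonicBins, harmonicClass, nextFitBins]
  · have hpos' : (0 : ℝ) < staticOpt L := by exact_mod_cast hpos
    have : ((harmonicBins k L : ℝ) - k) / staticOpt L ≤ harmonicRatio k := by
      refine le_csInf ⟨2, k, fun L hL => ?_⟩ fun c hc => ?_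
      · calc (harmonicBins k L : ℝ) =
              ∑ j ∈ Finset.Icc 1 k, (nextFitBins (harmonicClass k j L) : ℝ) := by
              rw [harmonicBins]; push_cast; rfl
          _ ≤ ∑ j ∈ Finset.Icc 1 k, (2 * (harmonicClass k j L).sum + 1) :=
              Finset.sum_le_sum fun j _ => nextFitBins_le (hL.harmonicClass_pos k j)
          _ = 2 * ∑ j ∈ Finset.Icc 1 k, (harmonicClass k j L).sum + k := by
              rw [Finset.sum_add_distrib, ← Finset.mul_sum]; simp
          _ ≤ 2 * staticOpt L + k := by
              have h1 := sum_harmonicClass_le (k := k) hL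
              have h2 := sum_le_staticOpt hL
              linarith
      · rw [div_le_iff₀ hpos']
        exact key c hc
    rw [div_le_iff₀ hpos'] at this
    linarith

/-- The requests that are active at a given time can be packed into the machines that are active at
that time. -/
lemma Instance.staticOpt_active_le (I : Instance) {σ : Fin I.n → ℕ} (hσ : I.Feasible σ) {t : ℝ}
    {l : List (Fin I.n)} (hl : l.Nodup) (ha : ∀ i ∈ l, i ∈ I.active t) :
    staticOpt (l.map fun i => (I.req i).size) ≤ (I.activeLabels σ t).card := by
  classical
  have hlen : (l.map fun i => (I.req i).size).length = l.length := List.length_map _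
  have hmem : ∀ i : Fin (l.map fun i => (I.req i).size).length,
      σ (l.get (i.cast hlen)) ∈ I.activeLabels σ t := fun i =>
    mem_activeLabels.2 ⟨_, ha _ (List.get_mem _ _), rfl⟩
  refine Nat.sInf_le ⟨fun i => (I.activeLabels σ t).equivFin ⟨_, hmem i⟩, fun c => ?_⟩
  refine le_trans ?_ ((I.feasible_iff σ).1 hσ t ((I.activeLabels σ t).equivFin.symm c))
  have hinj : Function.Injective fun i : Fin (l.map fun i => (I.req i).size).length =>
      l.get (i.cast hlen) := fun i j hij => by
    have := (List.nodup_iff_injective_get.1 hl) hij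
    simpa [Fin.ext_iff] using this
  calc _ = ∑ x ∈ (Finset.univ.filter fun i => (I.activeLabels σ t).equivFin ⟨_, hmem i⟩ = c).image
          (fun i => l.get (i.cast hlen)), (I.req x).size := by
        rw [Finset.sum_image fun i _ j _ h => hinj h]
        exact Finset.sum_congr rfl fun i _ => by simp
    _ ≤ _ := by
        refine I.sum_le_loadOn fun x hx => ?_
        obtain ⟨i, hi, rfl⟩ := Finset.mem_image.1 hx
        rw [Finset.mem_filter] at hi
        refine ⟨ha _ (List.get_mem _ _), ?_⟩
        rw [← hi.2, Equiv.symm_apply_apply]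

/-! ### The algorithm for known average load -/

/-- The pools of machines of the algorithm for known average load. -/
inductive Pool
  /-- Requests of the frequent duration class `q`, of the harmonic class `κ`, that depart in the
  `j`-th departure window of the duration class. -/
  | frequent (q j : ℤ) (κ : ℕ)
  /-- Small requests of all rare duration classes. -/
  | shared
  /-- Small requests of the rare duration class `q` for which the shared pool has no quota. -/
  | overflow (q : ℤ)
  /-- A pool for the `i`-th request only. -/
  | own (i : ℕ)
  deriving DecidableEq, Countable

instance : Inhabited Pool := ⟨.shared⟩

/-- The duration class of a request of duration `ℓ`, relative to the duration `ℓ₀` of the first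
request: `2 ^ q * ℓ₀ ≤ ℓ < 2 ^ (q + 1) * ℓ₀` for class `q`. -/
def durationClass (ℓ₀ ℓ : ℝ) : ℤ := Int.log 2 (ℓ / ℓ₀)

/-- The quota of the duration class `q`: the average load divided by the rank `|q| + 1` of the
class, under a square root. The class is frequent if its quota is at least `1`, and rare
otherwise. -/
def quota (v : ℝ) (q : ℤ) : ℝ := √(v / ((q.natAbs : ℝ) + 1))

/-- The length of the departure windows of the frequent duration class `q`. -/
def windowLength (ℓ₀ v : ℝ) (q : ℤ) : ℝ := 2 ^ q * ℓ₀ / quota v q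

/-- The duration of the first request, when `r` arrives after the requests in `past`. -/
def firstDuration {β : Type*} (past : List (Request × β)) (r : Request) : ℝ :=
  (past.head?.map fun x => x.1.length).getD r.length

/-- The assignment rule for known average load `v`. Requests of frequent duration classes are
grouped by duration class, departure window and harmonic class, and packed by Next-Fit in each
group. A request of a rare duration class gets its own machine if it is large compared with the
quota of the class. Otherwise it is put by First Fit into the shared pool, as long as the load of
its class in the shared pool stays within the quota, and then into the overflow pool of the
class. -/
def avgLoadRule (k : ℕ) (v : ℝ) (past : List (Request × (Pool × ℕ))) (r : Request) : Pool × ℕ :=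
  let ℓ₀ := firstDuration past r
  let q := durationClass ℓ₀ r.length
  if 1 ≤ quota v q then
    let p := Pool.frequent q ⌊r.finish / windowLength ℓ₀ v q⌋ (harmonicIndex k r.size)
    (p, nextFitBins (((past.filter fun x => x.2.1 = p).map fun x => x.1.size) ++ [r.size]))
  else if quota v q / 2 < r.size then (Pool.own past.length, 0)
  else if pastLoad id past (fun x => x.2.1 = Pool.shared ∧ durationClass ℓ₀ x.1.length = q) r.start
      + r.size ≤ quota v q then
    (Pool.shared, firstFitBin id past r Pool.shared)
  else (Pool.overflow q, firstFitBin id past r (Pool.overflow q))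

lemma quota_pos {v : ℝ} (hv : 1 ≤ v) (q : ℤ) : 0 < quota v q := by
  rw [quota]; positivity

namespace Instance

variable (I : Instance) (k : ℕ) (v : ℝ)

/-- The duration of the first request. -/
def baseLength : ℝ := (I.req ⟨0, I.n_pos⟩).length

/-- The duration class of request `i`. -/
def cls (i : Fin I.n) : ℤ := durationClass I.baseLength (I.req i).length

/-- The lower end of the range of durations in class `q`. -/
def clsLength (q : ℤ) : ℝ := 2 ^ q * I.baseLength

/-- The machines chosen by `avgLoadRule`. -/
def label (i : Fin I.n) : Pool × ℕ := decision (avgLoadRule k v) I.req i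

/-- The departure window of request `i`. -/
def window (i : Fin I.n) : ℤ :=
  ⌊(I.req i).finish / windowLength I.baseLength v (I.cls i)⌋

/-- The sizes of the requests of the pool `p` in the list `l`. -/
def poolSizes (p : Pool) (l : List (Fin I.n)) : List ℝ :=
  (l.filter fun j => (I.label k v j).1 = p).map fun j => (I.req j).size

lemma length_pos (i : Fin I.n) : 0 < (I.req i).length := sub_pos.2 (I.start_lt_finish i)

lemma baseLength_pos : 0 < I.baseLength := I.length_pos _

lemma clsLength_pos (q : ℤ) : 0 < I.clsLength q :=
  mul_pos (zpow_pos two_pos q) I.baseLength_pos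

lemma clsLength_le (i : Fin I.n) : I.clsLength (I.cls i) ≤ (I.req i).length := by
  have := Int.zpow_log_le_self (b := 2) one_lt_two (div_pos (I.length_pos i) I.baseLength_pos)
  rw [le_div_iff₀ I.baseLength_pos] at this
  exact_mod_cast this

lemma length_lt (i : Fin I.n) : (I.req i).length < 2 * I.clsLength (I.cls i) := by
  have := Int.lt_zpow_succ_log_self (b := 2) one_lt_two ((I.req i).length / I.baseLength)
  rw [div_lt_iff₀ I.baseLength_pos, Nat.cast_ofNat, zpow_add_one₀ two_ne_zero] at this
  rw [clsLength, cls, durationClass]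
  linarith

lemma finish_eq (i : Fin I.n) : (I.req i).finish = (I.req i).start + (I.req i).length := by
  rw [Request.length]; ring

lemma firstDuration_eq {β : Type*} (d : Fin I.n → β) (i : Fin I.n) :
    firstDuration (((List.finRange I.n).take i).map fun j => (I.req j, d j)) (I.req i) =
      I.baseLength := by
  rw [firstDuration, List.head?_map, List.head?_take]
  split_ifs with h
  · have : i = ⟨0, I.n_pos⟩ := Fin.ext h
    rw [this]; rfl
  · have : (List.finRange I.n).head? = some ⟨0, I.n_pos⟩ := by
      rw [List.head?_eq_getElem?, List.getElem?_eq_getElem (by simp [I.n_pos])]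
      simp
    rw [this]; rfl

lemma poolSizes_append (p : Pool) (l₁ l₂ : List (Fin I.n)) :
    I.poolSizes k v p (l₁ ++ l₂) = I.poolSizes k v p l₁ ++ I.poolSizes k v p l₂ := by
  simp [poolSizes]

lemma label_of_frequent {i : Fin I.n} (hi : 1 ≤ quota v (I.cls i)) :
    (I.label k v i).1 =
      Pool.frequent (I.cls i) (I.window v i) (harmonicIndex k (I.req i).size) ∧
    (I.label k v i).2 =
      nextFitBins (I.poolSizes k v (I.label k v i).1 ((List.finRange I.n).take (i + 1))) := by
  classical
  have key : I.label k v i = avgLoadRule k v _ _ := decision_eq _ _ _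
  simp only [avgLoadRule, I.firstDuration_eq] at key
  change _ = if 1 ≤ quota v (I.cls i) then _ else _ at key
  rw [if_pos hi] at key
  have h1 := congrArg Prod.fst key
  have h2 := congrArg Prod.snd key
  simp only at h1 h2
  refine ⟨h1, ?_⟩
  rw [h2, ← h1]
  have h3 := take_succ_ofFn (id : Fin I.n → Fin I.n) i
  rw [List.ofFn_id] at h3
  rw [h3, poolSizes_append]
  congr 1
  simp only [poolSizes, List.filter_map, List.map_map]
  rw [List.filter_singleton]
  simp only [id, decide_true, cond_true, List.map_cons, List.map_nil]
  rfl

lemma label_of_large {i : Fin I.n} (h₁ : quota v (I.cls i) < 1)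
    (h₂ : quota v (I.cls i) / 2 < (I.req i).size) : I.label k v i = (Pool.own i, 0) := by
  have key : I.label k v i = avgLoadRule k v _ _ := decision_eq _ _ _
  simp only [avgLoadRule, I.firstDuration_eq] at key
  change _ = if 1 ≤ quota v (I.cls i) then _ else if quota v (I.cls i) / 2 < _ then _ else _ at key
  rw [if_neg h₁.not_ge, if_pos h₂] at key
  simpa using key

/-- The load of the duration class of request `i` in the shared pool before the arrival of `i`. -/
def sharedBefore (i : Fin I.n) : ℝ :=
  I.loadOn (fun j => j < i ∧ (I.label k v j).1 = Pool.shared ∧ I.cls j = I.cls i) (I.req i).start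

lemma label_of_small {i : Fin I.n} (h₁ : quota v (I.cls i) < 1)
    (h₂ : (I.req i).size ≤ quota v (I.cls i) / 2) : I.FirstFitAt (I.label k v) i ∧
      (((I.label k v i).1 = Pool.shared ∧
        I.sharedBefore k v i + (I.req i).size ≤ quota v (I.cls i)) ∨
      ((I.label k v i).1 = Pool.overflow (I.cls i) ∧
        quota v (I.cls i) < I.sharedBefore k v i + (I.req i).size)) := by
  have key : I.label k v i = avgLoadRule k v _ _ := decision_eq _ _ _
  have hff : ∀ p, I.label k v i = (p, firstFitBin id
      (((List.finRange I.n).take i).map fun j => (I.req j, I.label k v j)) (I.req i) p) →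
      I.FirstFitAt (I.label k v) i := by
    intro p hp
    rw [FirstFitAt]
    have h1 := congrArg Prod.fst hp
    have h2 := congrArg Prod.snd hp
    simp only at h1 h2
    rw [h2, firstFitBin, ← h1]
    congr 1
    ext b
    rw [Set.mem_ofPred_eq, I.pastLoad_take id (fun j => rfl)]
    rfl
  simp only [avgLoadRule, I.firstDuration_eq] at key
  rw [I.pastLoad_take id (fun j => rfl)] at key
  change _ = if 1 ≤ quota v (I.cls i) then _ else if quota v (I.cls i) / 2 < _ then _ else
    if I.sharedBefore k v i + (I.req i).size ≤ quota v (I.cls i) then _ else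
      (Pool.overflow (I.cls i), _) at key
  rw [if_neg h₁.not_ge, if_neg h₂.not_gt] at key
  split_ifs at key with h
  · exact ⟨hff _ key, Or.inl ⟨congrArg Prod.fst key, h⟩⟩
  · exact ⟨hff _ key, Or.inr ⟨congrArg Prod.fst key, not_le.1 h⟩⟩

lemma label_cases (i : Fin I.n) :
    1 ≤ quota v (I.cls i) ∨
    (quota v (I.cls i) < 1 ∧ quota v (I.cls i) / 2 < (I.req i).size) ∨
    (quota v (I.cls i) < 1 ∧ (I.req i).size ≤ quota v (I.cls i) / 2) := by
  rcases le_or_gt 1 (quota v (I.cls i)) with h | h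
  · exact Or.inl h
  · rcases le_or_gt (I.req i).size (quota v (I.cls i) / 2) with h' | h'
    · exact Or.inr (Or.inr ⟨h, h'⟩)
    · exact Or.inr (Or.inl ⟨h, h'⟩)

variable {k v}

lemma frequent_of_label {i : Fin I.n} {q j : ℤ} {κ : ℕ}
    (h : (I.label k v i).1 = Pool.frequent q j κ) :
    1 ≤ quota v (I.cls i) ∧ q = I.cls i ∧ j = I.window v i ∧
      κ = harmonicIndex k (I.req i).size := by
  rcases I.label_cases v i with h1 | h1 | h1
  · rw [(I.label_of_frequent k v h1).1] at h
    injection h with h2 h3 h4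
    exact ⟨h1, h2.symm, h3.symm, h4.symm⟩
  · rw [I.label_of_large k v h1.1 h1.2] at h
    cases h
  · rcases (I.label_of_small k v h1.1 h1.2).2 with h2 | h2
    · rw [h2.1] at h; cases h
    · rw [h2.1] at h; cases h

lemma small_of_shared {i : Fin I.n} (h : (I.label k v i).1 = Pool.shared) :
    quota v (I.cls i) < 1 ∧ (I.req i).size ≤ quota v (I.cls i) / 2 ∧
      I.sharedBefore k v i + (I.req i).size ≤ quota v (I.cls i) := by
  rcases I.label_cases v i with h1 | h1 | h1
  · rw [(I.label_of_frequent k v h1).1] at h; cases h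
  · rw [I.label_of_large k v h1.1 h1.2] at h; cases h
  · rcases (I.label_of_small k v h1.1 h1.2).2 with h2 | h2
    · exact ⟨h1.1, h1.2, h2.2⟩
    · rw [h2.1] at h; cases h

lemma small_of_overflow {i : Fin I.n} {q : ℤ} (h : (I.label k v i).1 = Pool.overflow q) :
    I.cls i = q ∧ quota v (I.cls i) < 1 ∧ (I.req i).size ≤ quota v (I.cls i) / 2 ∧
      quota v (I.cls i) < I.sharedBefore k v i + (I.req i).size := by
  rcases I.label_cases v i with h1 | h1 | h1
  · rw [(I.label_of_frequent k v h1).1] at h; cases h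
  · rw [I.label_of_large k v h1.1 h1.2] at h; cases h
  · rcases (I.label_of_small k v h1.1 h1.2).2 with h2 | h2
    · rw [h2.1] at h; cases h
    · rw [h2.1] at h; injection h with h3
      exact ⟨h3, h1.1, h1.2, h2.2⟩

lemma large_of_own {i : Fin I.n} {m : ℕ} (h : (I.label k v i).1 = Pool.own m) :
    m = i ∧ quota v (I.cls i) < 1 ∧ quota v (I.cls i) / 2 < (I.req i).size := by
  rcases I.label_cases v i with h1 | h1 | h1
  · rw [(I.label_of_frequent k v h1).1] at h; cases h
  · rw [I.label_of_large k v h1.1 h1.2] at h; injection h with h3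
    exact ⟨h3.symm, h1⟩
  · rcases (I.label_of_small k v h1.1 h1.2).2 with h2 | h2
    · rw [h2.1] at h; cases h
    · rw [h2.1] at h; cases h

/-- In a group of frequent requests, the level in the state of Next-Fit is at most `1` and bounds
the total size of the requests on the active machine, and no machine of the group has a number
beyond the active one. -/
lemma nextFit_invariant {q j : ℤ} {κ : ℕ} (m : ℕ) (hm : m ≤ I.n) :
    ((I.poolSizes k v (.frequent q j κ) ((List.finRange I.n).take m)).foldl
      nextFitStep (0, 0)).2 ≤ 1 ∧
    (∑ i : Fin I.n, if (i : ℕ) < m ∧ I.label k v i = (.frequent q j κ,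
      ((I.poolSizes k v (.frequent q j κ) ((List.finRange I.n).take m)).foldl
        nextFitStep (0, 0)).1) then (I.req i).size else 0) ≤
    ((I.poolSizes k v (.frequent q j κ) ((List.finRange I.n).take m)).foldl
      nextFitStep (0, 0)).2 ∧
    ∀ i : Fin I.n, (i : ℕ) < m → (I.label k v i).1 = .frequent q j κ → (I.label k v i).2 ≤
      ((I.poolSizes k v (.frequent q j κ) ((List.finRange I.n).take m)).foldl
        nextFitStep (0, 0)).1 := by
  classical
  induction m with
  | zero => simp [poolSizes]
  | succ m ih =>
    obtain ⟨h1, h2, h3⟩ := ih (by omega)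
    set x : Fin I.n := ⟨m, hm⟩ with hx
    have hxm : (x : ℕ) = m := rfl
    have h4 : (List.finRange I.n).take (m + 1) = (List.finRange I.n).take m ++ [x] := by
      have := take_succ_ofFn (id : Fin I.n → Fin I.n) x
      rw [List.ofFn_id] at this
      exact this
    have hlt : ∀ i : Fin I.n, (i : ℕ) < m + 1 → i ≠ x → (i : ℕ) < m := fun i hi hne =>
      lt_of_le_of_ne (Nat.lt_succ_iff.1 hi) fun h => hne (Fin.ext h)
    by_cases hp : (I.label k v x).1 = .frequent q j κ
    · obtain ⟨hfreq, -⟩ := I.frequent_of_label hp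
      have hbin := (I.label_of_frequent k v hfreq).2
      have h5 : I.poolSizes k v (.frequent q j κ) ((List.finRange I.n).take (m + 1)) =
          I.poolSizes k v (.frequent q j κ) ((List.finRange I.n).take m) ++ [(I.req x).size] := by
        rw [h4, poolSizes_append]
        simp [poolSizes, hp]
      rw [hxm, hp, nextFitBins] at hbin
      rw [h5, foldl_nextFitStep_concat] at hbin ⊢
      set s := (I.poolSizes k v (.frequent q j κ) ((List.finRange I.n).take m)).foldl
        nextFitStep (0, 0) with hs
      have hsplit : ∀ b, (∑ i : Fin I.n, if (i : ℕ) < m + 1 ∧ I.label k v i = (.frequent q j κ, b)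
          then (I.req i).size else 0) =
          (∑ i : Fin I.n, if (i : ℕ) < m ∧ I.label k v i = (.frequent q j κ, b)
            then (I.req i).size else 0) +
          if (I.label k v x).2 = b then (I.req x).size else 0 := by
        intro b
        rw [← Finset.add_sum_erase _ _ (Finset.mem_univ x), ← Finset.add_sum_erase (a := x)
          _ (fun i : Fin I.n => if (i : ℕ) < m ∧ I.label k v i = (.frequent q j κ, b)
            then (I.req i).size else 0) (Finset.mem_univ x)]
        have e1 : ∀ i ∈ Finset.univ.erase x,
            (if (i : ℕ) < m + 1 ∧ I.label k v i = (.frequent q j κ, b)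
              then (I.req i).size else 0) =
            if (i : ℕ) < m ∧ I.label k v i = (.frequent q j κ, b)
              then (I.req i).size else 0 := by
          intro i hi
          refine if_congr (and_congr_left fun _ => ⟨fun h => hlt i h (Finset.ne_of_mem_erase hi),
            fun h => by omega⟩) rfl rfl
        rw [Finset.sum_congr rfl e1]
        have e2 : I.label k v x = (.frequent q j κ, b) ↔ (I.label k v x).2 = b := by
          rw [Prod.ext_iff]; simp [hp]
        simp only [hxm, e2, lt_irrefl, false_and, if_false, Nat.lt_succ_self, true_and]
        ring
      refine ⟨?_, ?_, ?_⟩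
      · rw [nextFitStep]
        split_ifs with h
        · exact h.2
        · exact I.size_le_one x
      · rw [hsplit, if_pos hbin]
        rw [nextFitStep]
        split_ifs with h
        · exact add_le_add_left h2 _
        · rw [Finset.sum_eq_zero]
          · simp
          · intro i _
            rw [if_neg]
            rintro ⟨him, hi⟩
            have := h3 i him (by rw [hi])
            rw [hi] at this
            simp at this
      · intro i hi hip
        by_cases hix : i = x
        · rw [hix, hbin]
        · exact (h3 i (hlt i hi hix) hip).trans (nextFitStep_fst_mono _ _)
    · have h5 : I.poolSizes k v (.frequent q j κ) ((List.finRange I.n).take (m + 1)) =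
          I.poolSizes k v (.frequent q j κ) ((List.finRange I.n).take m) := by
        rw [h4, poolSizes_append]
        simp [poolSizes, hp]
      rw [h5]
      refine ⟨h1, le_of_eq_of_le (Finset.sum_congr rfl fun i _ => ?_) h2, fun i hi hip => ?_⟩
      · refine if_congr (and_congr_left fun hi => ⟨fun h => hlt i h ?_, fun h => by omega⟩) rfl rfl
        rintro rfl
        exact hp (by rw [hi])
      · refine h3 i (hlt i hi ?_) hip
        rintro rfl
        exact hp hip

lemma label_fits (i : Fin I.n) :
    I.loadOn (fun j => j < i ∧ I.label k v j = I.label k v i) (I.req i).start +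
      (I.req i).size ≤ 1 := by
  classical
  rcases I.label_cases v i with h | h | h
  · obtain ⟨hp, hb⟩ := I.label_of_frequent k v h
    obtain ⟨h1, h2, -⟩ := I.nextFit_invariant (k := k) (v := v) (q := I.cls i) (j := I.window v i)
      (κ := harmonicIndex k (I.req i).size) (i + 1) i.2
    refine le_trans ?_ (h2.trans h1)
    rw [hp, nextFitBins] at hb
    rw [← hb, ← Finset.sum_filter, ← hp]
    refine (add_le_add_left (I.loadOn_le_sum (s := Finset.univ.filter fun j =>
      j < i ∧ I.label k v j = I.label k v i) fun j _ hj =>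
        Finset.mem_filter.2 ⟨Finset.mem_univ _, hj⟩) _).trans ?_
    rw [← Finset.sum_singleton (fun j => (I.req j).size) i, ← Finset.sum_union]
    · refine Finset.sum_le_sum_of_subset_of_nonneg (fun j hj => ?_) fun i _ _ => (I.size_pos i).le
      rw [Finset.mem_union, Finset.mem_filter, Finset.mem_singleton] at hj
      rw [Finset.mem_filter]
      rcases hj with ⟨-, h1, h2⟩ | rfl
      · exact ⟨Finset.mem_univ _, Nat.lt_succ_of_lt h1, h2⟩
      · exact ⟨Finset.mem_univ _, Nat.lt_succ_self _, rfl⟩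
    · rw [Finset.disjoint_singleton_right, Finset.mem_filter]
      exact fun h => lt_irrefl _ h.2.1
  · rw [I.loadOn_eq_zero, zero_add]
    · exact I.size_le_one i
    · rintro j - ⟨hlt, hj⟩
      rw [I.label_of_large k v h.1 h.2] at hj
      have := (I.large_of_own (i := j) (by rw [hj])).1
      exact hlt.ne (Fin.ext this.symm)
  · exact (I.label_of_small k v h.1 h.2).1.fits

end Instance

/-! ### Sums of quotas -/

lemma sum_one_div_sqrt_le (N : ℕ) : ∑ m ∈ Finset.range N, 1 / √((m : ℝ) + 1) ≤ 2 * √N := by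
  induction N with
  | zero => simp
  | succ N ih =>
    rw [Finset.sum_range_succ]
    push_cast
    have h1 : 0 < √((N : ℝ) + 1) := by positivity
    have h2 : √((N : ℝ) + 1) ^ 2 = N + 1 := Real.sq_sqrt (by positivity)
    have h3 : √(N : ℝ) ^ 2 = N := Real.sq_sqrt (by positivity)
    have h4 : 1 / √((N : ℝ) + 1) ≤ 2 * √((N : ℝ) + 1) - 2 * √N := by
      rw [div_le_iff₀ h1]
      nlinarith [sq_nonneg (√((N : ℝ) + 1) - √N)]
    linarith

lemma sum_quota_le {v : ℝ} (hv : 0 ≤ v) {Q : Finset ℤ} {P : ℝ}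
    (hQ : ∀ q ∈ Q, (q.natAbs : ℝ) + 1 ≤ P) (hP : 0 ≤ P) : ∑ q ∈ Q, quota v q ≤ 4 * √(v * P) := by
  have hmaps : ∀ q ∈ Q, q.natAbs ∈ Finset.range ⌊P⌋₊ := by
    intro q hq
    rw [Finset.mem_range, ← Nat.succ_le_iff, Nat.le_floor_iff hP]
    push_cast
    exact hQ q hq
  have h1 : ∑ q ∈ Q, 1 / √((q.natAbs : ℝ) + 1) ≤ 4 * √P := by
    rw [← Finset.sum_fiberwise_of_maps_to hmaps]
    calc _ ≤ ∑ m ∈ Finset.range ⌊P⌋₊, 2 * (1 / √((m : ℝ) + 1)) := by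
          refine Finset.sum_le_sum fun m _ => ?_
          have hc : (Q.filter fun q => q.natAbs = m).card ≤ 2 := by
            refine (Finset.card_le_card (t := {(m : ℤ), -(m : ℤ)}) fun q hq => ?_).trans
              Finset.card_le_two
            rw [Finset.mem_filter] at hq
            rw [Finset.mem_insert, Finset.mem_singleton]
            omega
          rw [Finset.sum_congr rfl (g := fun _ => 1 / √((m : ℝ) + 1)) fun q hq => by
            rw [(Finset.mem_filter.1 hq).2], Finset.sum_const, nsmul_eq_mul]
          have : ((Q.filter fun q => q.natAbs = m).card : ℝ) ≤ 2 := by exact_mod_cast hc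
          gcongr
      _ ≤ 2 * (2 * √(⌊P⌋₊ : ℝ)) := by
          rw [← Finset.mul_sum]
          gcongr
          exact sum_one_div_sqrt_le _
      _ ≤ 2 * (2 * √P) := by
          gcongr
          exact Nat.floor_le hP
      _ = 4 * √P := by ring
  have h2 : ∀ q : ℤ, quota v q = √v * (1 / √((q.natAbs : ℝ) + 1)) := by
    intro q
    rw [quota, Real.sqrt_div hv]
    ring
  simp only [h2]
  rw [← Finset.mul_sum, Real.sqrt_mul hv]
  calc _ ≤ √v * (4 * √P) := by gcongr
    _ = _ := by ring

lemma natCast_le_two_mul_log {μ : ℝ} {m : ℕ} (h : (2 : ℝ) ^ m ≤ μ) : (m : ℝ) ≤ 2 * Real.log μ := by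
  have h1 := Real.log_le_log (by positivity) h
  rw [Real.log_pow] at h1
  have h2 := Real.log_two_gt_d9
  have h3 : (0 : ℝ) ≤ m := Nat.cast_nonneg m
  nlinarith

namespace Instance

variable (I : Instance) {k : ℕ} {v : ℝ}

/-- An upper bound for the ranks `|q| + 1` of the duration classes `q` of the instance. -/
def rankBound : ℝ := 2 * (1 + Real.log I.mu)

lemma length_div_le_mu (i j : Fin I.n) : (I.req i).length / (I.req j).length ≤ I.mu := by
  have h1 : (I.req i).length ≤ I.maxLength :=
    le_ciSup (Set.finite_range fun i => (I.req i).length).bddAbove i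
  have h2 : I.minLength ≤ (I.req j).length :=
    ciInf_le (Set.finite_range fun i => (I.req i).length).bddBelow j
  have h3 : 0 < I.minLength := by
    obtain ⟨m, hm⟩ : ∃ m, (I.req m).length = I.minLength := exists_eq_ciInf_of_finite
    rw [← hm]; exact I.length_pos m
  exact div_le_div₀ ((I.length_pos i).le.trans h1) h1 h3 h2

lemma rank_le (i : Fin I.n) : ((I.cls i).natAbs : ℝ) + 1 ≤ I.rankBound := by
  have h1 := I.clsLength_le i
  have h2 := I.length_lt i
  have h0 := I.baseLength_pos
  rw [clsLength] at h1 h2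
  have hμ : 0 ≤ Real.log I.mu := Real.log_nonneg ((div_self (I.length_pos i).ne').symm.le.trans
    (I.length_div_le_mu i i))
  rw [rankBound]
  rcases le_or_gt 0 (I.cls i) with h | h
  · have : (2 : ℝ) ^ (I.cls i).natAbs ≤ I.mu := by
      refine le_trans ?_ (I.length_div_le_mu i ⟨0, I.n_pos⟩)
      rw [← zpow_natCast, Int.natAbs_of_nonneg h]
      exact (le_div_iff₀ h0).2 h1
    have := natCast_le_two_mul_log this
    linarith
  · obtain ⟨m, hm⟩ : ∃ m : ℕ, I.cls i = -(m + 1 : ℕ) := ⟨(I.cls i).natAbs - 1, by omega⟩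
    have : (2 : ℝ) ^ m ≤ I.mu := by
      refine le_trans ?_ (I.length_div_le_mu ⟨0, I.n_pos⟩ i)
      rw [le_div_iff₀ (I.length_pos i)]
      rw [hm, zpow_neg, zpow_natCast] at h2
      have e : 2 * (((2 : ℝ) ^ (m + 1))⁻¹ * I.baseLength) = I.baseLength / 2 ^ m := by
        rw [pow_succ]; field_simp
      rw [e, lt_div_iff₀ (by positivity)] at h2
      rw [mul_comm]
      exact h2.le
    have := natCast_le_two_mul_log this
    rw [hm]
    simp only [Int.natAbs_neg, Int.natAbs_natCast]
    push_cast
    linarith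

lemma two_le_rankBound : 2 ≤ I.rankBound := by
  have hμ : 0 ≤ Real.log I.mu := Real.log_nonneg
    ((div_self (I.length_pos ⟨0, I.n_pos⟩).ne').symm.le.trans (I.length_div_le_mu _ _))
  rw [rankBound]; linarith

/-- The duration classes of the requests. -/
def classes : Finset ℤ := Finset.univ.image I.cls

lemma cls_mem_classes (i : Fin I.n) : I.cls i ∈ I.classes :=
  Finset.mem_image_of_mem _ (Finset.mem_univ i)

lemma sum_classes_quota_le (hv : 1 ≤ v) :
    ∑ q ∈ I.classes, quota v q ≤ 4 * √(v * I.rankBound) := by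
  refine sum_quota_le (by linarith) (fun q hq => ?_) (by linarith [I.two_le_rankBound])
  obtain ⟨i, -, rfl⟩ := Finset.mem_image.1 hq
  exact I.rank_le i

lemma one_div_quota_le (hv : 1 ≤ v) (i : Fin I.n) :
    1 / quota v (I.cls i) ≤ √(I.rankBound / v) := by
  rw [quota, one_div, ← Real.sqrt_inv, inv_div]
  gcongr
  exact I.rank_le i

/-! ### Frequent duration classes -/

variable (k v) in
/-- The groups of the frequent requests that are active at time `t`. -/
def frequentPools (t : ℝ) : Finset Pool :=
  ((I.active t).filter fun i => 1 ≤ quota v (I.cls i)).image fun i => (I.label k v i).1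

variable (v) in
/-- The group `p` is pending at time `t` if its departure window begins after `t`. -/
def Pending (t : ℝ) (p : Pool) : Prop :=
  ∃ q j κ, p = .frequent q j κ ∧ t < j * windowLength I.baseLength v q

/-- The requests that have arrived up to time `t`. -/
def arrived (t : ℝ) : List (Fin I.n) := (List.finRange I.n).filter fun i => (I.req i).start ≤ t

variable (v) in
/-- The contribution of the departure window of request `i` to the number of machines at time `t`
that are not accounted for by full machines. -/
def windowLoad (t : ℝ) (i : Fin I.n) : ℝ :=
  (Ico (I.window v i * windowLength I.baseLength v (I.cls i))
    ((I.window v i + 1) * windowLength I.baseLength v (I.cls i))).indicator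
    (fun _ => (I.req i).size) t

lemma windowLoad_nonneg (t : ℝ) (i : Fin I.n) : 0 ≤ I.windowLoad v t i :=
  Set.indicator_nonneg (fun _ _ => (I.size_pos i).le) t

lemma windowLength_pos (hv : 1 ≤ v) (q : ℤ) : 0 < windowLength I.baseLength v q :=
  div_pos (I.clsLength_pos q) (quota_pos hv q)

lemma window_mul_le (hv : 1 ≤ v) (i : Fin I.n) :
    I.window v i * windowLength I.baseLength v (I.cls i) ≤ (I.req i).finish := by
  rw [← le_div_iff₀ (I.windowLength_pos hv _)]
  exact Int.floor_le _

lemma finish_lt_window_mul (hv : 1 ≤ v) (i : Fin I.n) :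
    (I.req i).finish < (I.window v i + 1) * windowLength I.baseLength v (I.cls i) := by
  rw [← div_lt_iff₀ (I.windowLength_pos hv _)]
  exact Int.lt_floor_add_one _

lemma bin_le_nextFitBins {t : ℝ} {i : Fin I.n} (hi : i ∈ I.active t)
    (hq : 1 ≤ quota v (I.cls i)) : (I.label k v i).2 ∈
      Finset.Icc 1 (nextFitBins (I.poolSizes k v (I.label k v i).1 (I.arrived t))) := by
  rw [mem_active] at hi
  have h1 : (List.finRange I.n).take (i + 1) <+: I.arrived t := by
    refine ⟨((List.finRange I.n).drop (i + 1)).filter fun i => (I.req i).start ≤ t, ?_⟩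
    conv_rhs => rw [arrived, ← List.take_append_drop (i + 1) (List.finRange I.n),
      List.filter_append]
    congr 1
    symm
    rw [List.filter_eq_self]
    intro j hj
    obtain ⟨m, hm, rfl⟩ := List.mem_take_iff_getElem.1 hj
    have hle : (List.finRange I.n)[m]'(by simp at hm ⊢; omega) ≤ i := by
      rw [List.getElem_finRange, Fin.le_def]
      simp at hm ⊢
      omega
    rw [decide_eq_true_eq]
    exact (I.start_mono hle).trans hi.1
  have h2 : I.poolSizes k v (I.label k v i).1 ((List.finRange I.n).take (i + 1)) <+:
      I.poolSizes k v (I.label k v i).1 (I.arrived t) := by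
    obtain ⟨l, hl⟩ := h1
    exact ⟨I.poolSizes k v (I.label k v i).1 l, by rw [← poolSizes_append, hl]⟩
  rw [Finset.mem_Icc, (I.label_of_frequent k v hq).2]
  refine ⟨one_le_nextFitBins ?_, nextFitBins_prefix h2⟩
  have h3 := take_succ_ofFn (id : Fin I.n → Fin I.n) i
  rw [List.ofFn_id] at h3
  rw [h3, poolSizes_append]
  simp [poolSizes]

lemma card_frequent_le (t : ℝ) :
    (((I.active t).filter fun i => 1 ≤ quota v (I.cls i)).image (I.label k v)).card ≤
      ∑ p ∈ I.frequentPools k v t, nextFitBins (I.poolSizes k v p (I.arrived t)) := by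
  have : ((I.active t).filter fun i => 1 ≤ quota v (I.cls i)).image (I.label k v) ⊆
      (I.frequentPools k v t).biUnion fun p =>
        (Finset.Icc 1 (nextFitBins (I.poolSizes k v p (I.arrived t)))).image fun b => (p, b) := by
    intro x hx
    obtain ⟨i, hi, rfl⟩ := Finset.mem_image.1 hx
    rw [Finset.mem_biUnion]
    refine ⟨_, Finset.mem_image_of_mem _ hi, Finset.mem_image.2 ⟨_, ?_, rfl⟩⟩
    rw [Finset.mem_filter] at hi
    exact I.bin_le_nextFitBins hi.1 hi.2
  refine (Finset.card_le_card this).trans (Finset.card_biUnion_le.trans ?_)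
  refine Finset.sum_le_sum fun p _ => Finset.card_image_le.trans ?_
  simp

lemma poolSizes_pos {p : Pool} {l : List (Fin I.n)} : ∀ w ∈ I.poolSizes k v p l, 0 < w := by
  intro w hw
  obtain ⟨i, -, rfl⟩ := List.mem_map.1 hw
  exact I.size_pos i

lemma poolSizes_arrived_sum (p : Pool) (t : ℝ) : (I.poolSizes k v p (I.arrived t)).sum =
    ∑ i : Fin I.n, if (I.req i).start ≤ t ∧ (I.label k v i).1 = p then (I.req i).size else 0 := by
  rw [← Finset.sum_filter]
  have hnd : (((I.arrived t).filter fun i => (I.label k v i).1 = p)).Nodup :=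
    ((List.nodup_finRange I.n).filter _).filter _
  rw [poolSizes, ← List.sum_toFinset _ hnd]
  congr 1
  ext i
  simp [arrived, and_comm]

/-- The groups whose departure window has begun are charged to the windows of their requests. -/
lemma sum_not_pending_le (hv : 1 ≤ v) (t : ℝ) [DecidablePred (I.Pending v t)] :
    ∑ p ∈ (I.frequentPools k v t).filter (fun p => ¬ I.Pending v t p),
      (nextFitBins (I.poolSizes k v p (I.arrived t)) : ℝ) ≤
    2 * ∑ i, I.windowLoad v t i +
      ((I.frequentPools k v t).filter fun p => ¬ I.Pending v t p).card := by
  set Γ := (I.frequentPools k v t).filter fun p => ¬ I.Pending v t p with hΓ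
  have h1 : ∀ p ∈ Γ, (I.poolSizes k v p (I.arrived t)).sum ≤
      ∑ i : Fin I.n, if (I.label k v i).1 = p then I.windowLoad v t i else 0 := by
    intro p hp
    rw [poolSizes_arrived_sum]
    refine Finset.sum_le_sum fun i _ => ?_
    by_cases hi : (I.label k v i).1 = p
    · rw [if_pos hi]
      split_ifs with hs
      · rw [hΓ, Finset.mem_filter] at hp
        obtain ⟨x, hx, hxp⟩ := Finset.mem_image.1 hp.1
        rw [Finset.mem_filter, mem_active] at hx
        have hfx := (I.label_of_frequent k v hx.2).1
        have hfi := hi.trans (hxp.symm.trans hfx)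
        obtain ⟨-, hc, hw, -⟩ := I.frequent_of_label hfi
        have h2 := I.finish_lt_window_mul hv x
        have h3 : ¬ I.Pending v t p := hp.2
        rw [windowLoad, Set.indicator_of_mem]
        rw [← hc, ← hw]
        refine ⟨?_, hx.1.2.trans h2⟩
        by_contra hlt
        exact h3 ⟨_, _, _, hxp.symm.trans hfx, not_le.1 hlt⟩
      · exact I.windowLoad_nonneg t i
    · rw [if_neg hi, if_neg fun h => hi h.2]
  calc _ ≤ ∑ p ∈ Γ, (2 * (∑ i : Fin I.n,
          if (I.label k v i).1 = p then I.windowLoad v t i else 0) + 1) := by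
        refine Finset.sum_le_sum fun p hp => ?_
        have := nextFitBins_le (I.poolSizes_pos (k := k) (v := v) (p := p) (l := I.arrived t))
        have := h1 p hp
        linarith
    _ = 2 * ∑ i, ∑ p ∈ Γ, (if (I.label k v i).1 = p then I.windowLoad v t i else 0) + Γ.card := by
        rw [Finset.sum_add_distrib, ← Finset.mul_sum, Finset.sum_comm]
        simp
    _ ≤ _ := by
        gcongr with i _
        rw [Finset.sum_ite_eq]
        split_ifs
        · exact le_rfl
        · exact I.windowLoad_nonneg t i

/-- A frequent duration class has few departure windows within reach. -/
lemma card_frequentPools_le (hk : 1 ≤ k) (hv : 1 ≤ v) (t : ℝ) :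
    ((I.frequentPools k v t).card : ℝ) ≤ k * (16 * √(v * I.rankBound)) := by
  have hsub : I.frequentPools k v t ⊆ (I.classes.filter fun q => 1 ≤ quota v q).biUnion fun q =>
      (Finset.Icc ⌊t / windowLength I.baseLength v q⌋
        ⌊(t + 2 * I.clsLength q) / windowLength I.baseLength v q⌋ ×ˢ Finset.Icc 1 k).image
        fun x => Pool.frequent q x.1 x.2 := by
    intro p hp
    obtain ⟨i, hi, rfl⟩ := Finset.mem_image.1 hp
    rw [Finset.mem_filter, mem_active] at hi
    rw [Finset.mem_biUnion]
    refine ⟨I.cls i, Finset.mem_filter.2 ⟨I.cls_mem_classes i, hi.2⟩, Finset.mem_image.2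
      ⟨(I.window v i, harmonicIndex k (I.req i).size), ?_, (I.label_of_frequent k v hi.2).1.symm⟩⟩
    have hδ := I.windowLength_pos hv (I.cls i)
    have h1 := I.length_lt i
    have h2 := I.finish_eq i
    rw [Finset.mem_product, Finset.mem_Icc]
    refine ⟨⟨Int.floor_le_floor ?_, Int.floor_le_floor ?_⟩,
      harmonicIndex_mem hk (I.size_pos i) (I.size_le_one i)⟩
    · exact div_le_div_of_nonneg_right hi.1.2.le hδ.le
    · exact div_le_div_of_nonneg_right (by linarith) hδ.le
  calc ((I.frequentPools k v t).card : ℝ) ≤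
        ∑ q ∈ I.classes.filter fun q => 1 ≤ quota v q, k * (4 * quota v q) := by
        refine le_trans (Nat.cast_le.2 ((Finset.card_le_card hsub).trans
          Finset.card_biUnion_le)) ?_
        rw [Nat.cast_sum]
        refine Finset.sum_le_sum fun q hq => ?_
        have hq1 := (Finset.mem_filter.1 hq).2
        refine le_trans (Nat.cast_le.2 Finset.card_image_le) ?_
        rw [Finset.card_product, Nat.card_Icc, Nat.add_sub_cancel, Int.card_Icc, Nat.cast_mul,
          mul_comm]
        gcongr
        have hδ := I.windowLength_pos hv q
        have e : (t + 2 * I.clsLength q) / windowLength I.baseLength v q =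
            t / windowLength I.baseLength v q + 2 * quota v q := by
          rw [add_div, mul_div_assoc, windowLength, clsLength, div_div_cancel₀]
          exact (I.clsLength_pos q).ne'
        rw [e]
        set x := t / windowLength I.baseLength v q
        have h1 := Int.floor_le (x + 2 * quota v q)
        have h2 := Int.lt_floor_add_one x
        have h3 : ⌊x⌋ ≤ ⌊x + 2 * quota v q⌋ := Int.floor_le_floor (by linarith)
        have h4 : (((⌊x + 2 * quota v q⌋ + 1 - ⌊x⌋).toNat : ℤ) : ℝ) =
            ((⌊x + 2 * quota v q⌋ + 1 - ⌊x⌋ : ℤ) : ℝ) := by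
          rw [Int.toNat_of_nonneg (by omega)]
        rw [Int.cast_natCast] at h4
        rw [h4]
        push_cast
        linarith
    _ ≤ ∑ q ∈ I.classes, k * (4 * quota v q) := by
        refine Finset.sum_le_sum_of_subset_of_nonneg (Finset.filter_subset _ _) fun q _ _ => ?_
        have := quota_pos hv q
        positivity
    _ ≤ _ := by
        rw [← Finset.mul_sum, ← Finset.mul_sum]
        have := I.sum_classes_quota_le hv
        exact mul_le_mul_of_nonneg_left (by linarith) (Nat.cast_nonneg k)

/-- The pending groups consist of active requests. -/
lemma mem_active_of_pending (hv : 1 ≤ v) {t : ℝ} {i : Fin I.n} (hi : i ∈ I.arrived t)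
    (hp : I.Pending v t (I.label k v i).1) : i ∈ I.active t := by
  obtain ⟨q, j, κ, hl, hlt⟩ := hp
  obtain ⟨-, rfl, rfl, -⟩ := I.frequent_of_label hl
  rw [arrived, List.mem_filter, decide_eq_true_eq] at hi
  exact mem_active.2 ⟨hi.2, hlt.trans_le (I.window_mul_le hv i)⟩

/-! ### Rare duration classes -/

lemma loadOn_shared_le (hv : 1 ≤ v) (q : ℤ) (t : ℝ) :
    I.loadOn (fun i => (I.label k v i).1 = .shared ∧ I.cls i = q) t ≤ quota v q := by
  refine I.loadOn_le_of_arrivals (quota_pos hv q).le (fun i hi => ?_) t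
  have := (I.small_of_shared hi.1).2.2
  rw [sharedBefore, hi.2] at this
  exact this

lemma loadOn_shared_total_le (hv : 1 ≤ v) (t : ℝ) :
    I.loadOn (fun i => (I.label k v i).1 = .shared) t ≤ 4 * √(v * I.rankBound) := by
  refine le_trans ?_ (I.sum_classes_quota_le hv)
  rw [loadOn_eq_sum, ← Finset.sum_fiberwise_of_maps_to fun i _ => I.cls_mem_classes i]
  refine Finset.sum_le_sum fun q _ => ?_
  refine (I.sum_le_loadOn fun i hi => ?_).trans (I.loadOn_shared_le (k := k) hv q t)
  rw [Finset.mem_filter, Finset.mem_filter] at hi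
  exact ⟨hi.1.1, hi.1.2, hi.2⟩

lemma card_image_le_of_bin_le {s : Finset (Fin I.n)} {p : Pool}
    (hs : ∀ i ∈ s, (I.label k v i).1 = p) {x : ℝ} (hx : 0 ≤ x)
    (hb : ∀ i ∈ s, ((I.label k v i).2 : ℝ) ≤ x) : ((s.image (I.label k v)).card : ℝ) ≤ x + 1 := by
  have : s.image (I.label k v) ⊆ (Finset.range (⌊x⌋₊ + 1)).image fun b => (p, b) := by
    intro y hy
    obtain ⟨i, hi, rfl⟩ := Finset.mem_image.1 hy
    refine Finset.mem_image.2 ⟨(I.label k v i).2, ?_, Prod.ext (hs i hi).symm rfl⟩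
    rw [Finset.mem_range, Nat.lt_succ_iff, Nat.le_floor_iff hx]
    exact hb i hi
  have h1 := (Finset.card_le_card this).trans Finset.card_image_le
  rw [Finset.card_range] at h1
  calc ((s.image (I.label k v)).card : ℝ) ≤ ((⌊x⌋₊ + 1 : ℕ) : ℝ) := Nat.cast_le.2 h1
    _ ≤ x + 1 := by push_cast; linarith [Nat.floor_le hx]

lemma card_shared_le (hv : 1 ≤ v) (t : ℝ) :
    ((((I.active t).filter fun i => (I.label k v i).1 = .shared).image (I.label k v)).card : ℝ) ≤
      8 * √(v * I.rankBound) + 1 := by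
  refine I.card_image_le_of_bin_le (fun i hi => (Finset.mem_filter.1 hi).2) (by positivity)
    fun i hi => ?_
  have hs := (Finset.mem_filter.1 hi).2
  obtain ⟨h1, h2, -⟩ := I.small_of_shared hs
  have h3 := (I.label_of_small k v h1 h2).1.bin_le (by linarith)
  have h4 := I.loadOn_shared_total_le (k := k) hv (I.req i).start
  have h5 : I.loadOn (fun j => j < i ∧ (I.label k v j).1 = (I.label k v i).1) (I.req i).start ≤
      I.loadOn (fun i => (I.label k v i).1 = .shared) (I.req i).start :=
    I.loadOn_mono fun j hj => hj.2.trans hs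
  linarith

variable (v) in
/-- The contribution of request `i` to the number of the machines at time `t` that are charged to
rare requests. -/
def rareLoad (t : ℝ) (i : Fin I.n) : ℝ :=
  (Ico (I.req i).start ((I.req i).finish + 2 * I.clsLength (I.cls i))).indicator
    (fun _ => 2 / quota v (I.cls i) * (I.req i).size) t

lemma rareLoad_nonneg (hv : 1 ≤ v) (t : ℝ) (i : Fin I.n) : 0 ≤ I.rareLoad v t i :=
  Set.indicator_nonneg (fun _ _ => mul_nonneg (div_nonneg zero_le_two (quota_pos hv _).le)
    (I.size_pos i).le) t

/-- A machine of an overflow pool is opened only if the shared load of its class exceeds half of the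
quota, and all machines opened before are half full. -/
lemma card_overflow_class_le (hv : 1 ≤ v) (t : ℝ) (q : ℤ) :
    ((((I.active t).filter fun i => (I.label k v i).1 = .overflow q).image
      (I.label k v)).card : ℝ) ≤ ∑ i, if I.cls i = q then I.rareLoad v t i else 0 := by
  set s := (I.active t).filter fun i => (I.label k v i).1 = .overflow q with hs
  rcases s.eq_empty_or_nonempty with he | hne
  · rw [he]
    simp only [Finset.image_empty, Finset.card_empty, Nat.cast_zero]
    refine Finset.sum_nonneg fun i _ => ?_
    split_ifs
    · exact I.rareLoad_nonneg hv t i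
    · exact le_rfl
  · obtain ⟨i, hi, hmax⟩ := Finset.exists_max_image s (fun i => (I.label k v i).2) hne
    refine (I.card_image_le_of_bin_le (fun j hj => (Finset.mem_filter.1 hj).2)
      (Nat.cast_nonneg (I.label k v i).2) fun j hj => Nat.cast_le.2 (hmax j hj)).trans ?_
    rw [hs, Finset.mem_filter, mem_active] at hi
    obtain ⟨hq, h1, h2, h3⟩ := I.small_of_overflow hi.2
    have h4 := (I.label_of_small k v h1 h2).1.bin_le (by linarith)
    have hpos := quota_pos hv (I.cls i)
    have h5 : I.loadOn (fun j => j < i ∧ (I.label k v j).1 = (I.label k v i).1) (I.req i).start +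
        I.sharedBefore k v i ≤ I.loadOn (fun j => I.cls j = q) (I.req i).start := by
      refine I.loadOn_add_le (fun j hj => ?_) (fun j hj => hj.2.2.trans hq) fun j hj hj' => ?_
      · exact (I.small_of_overflow (hj.2.trans hi.2)).1
      · have := hj.2.symm.trans hj'.2.1
        rw [hi.2] at this
        cases this
    have h6 : ((I.label k v i).2 : ℝ) + 1 ≤
        2 / quota v (I.cls i) * I.loadOn (fun j => I.cls j = q) (I.req i).start := by
      rw [div_mul_eq_mul_div, le_div_iff₀ hpos]
      have h7 := I.loadOn_nonneg
        (fun j => j < i ∧ (I.label k v j).1 = (I.label k v i).1) (I.req i).start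
      have h8 : ((I.label k v i).2 : ℝ) * quota v (I.cls i) ≤ (I.label k v i).2 :=
        mul_le_of_le_one_right (Nat.cast_nonneg _) h1.le
      linarith
    refine h6.trans ?_
    rw [loadOn_eq_sum, Finset.mul_sum, active, Finset.filter_filter, Finset.sum_filter]
    refine Finset.sum_le_sum fun j _ => ?_
    by_cases hj : I.cls j = q
    · rw [if_pos hj]
      split_ifs with hact
      · rw [rareLoad, Set.indicator_of_mem, hq, hj]
        have h8 := I.length_lt i
        have h9 := I.finish_eq i
        have h10 : (I.req j).start ≤ (I.req i).start ∧ (I.req i).start < (I.req j).finish := hact.1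
        rw [hj, ← hq]
        exact ⟨h10.1.trans hi.1.1, by linarith [hi.1.2]⟩
      · exact I.rareLoad_nonneg hv t j
    · rw [if_neg hj, if_neg fun h => hj h.2]

lemma card_overflow_le (hv : 1 ≤ v) {t : ℝ} {s : Finset (Fin I.n)}
    (hs : ∀ i ∈ s, i ∈ I.active t ∧ ∃ q, (I.label k v i).1 = .overflow q) :
    ((s.image (I.label k v)).card : ℝ) ≤ ∑ i, I.rareLoad v t i := by
  have hsub : s.image (I.label k v) ⊆ I.classes.biUnion fun q =>
      ((I.active t).filter fun i => (I.label k v i).1 = .overflow q).image (I.label k v) := by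
    intro x hx
    obtain ⟨i, hi, rfl⟩ := Finset.mem_image.1 hx
    obtain ⟨hi1, q, hq⟩ := hs i hi
    rw [Finset.mem_biUnion]
    refine ⟨q, ?_, Finset.mem_image_of_mem _ (Finset.mem_filter.2 ⟨hi1, hq⟩)⟩
    rw [← (I.small_of_overflow hq).1]
    exact I.cls_mem_classes i
  calc _ ≤ ∑ q ∈ I.classes, ((((I.active t).filter fun i =>
          (I.label k v i).1 = .overflow q).image (I.label k v)).card : ℝ) := by
        exact_mod_cast (Finset.card_le_card hsub).trans Finset.card_biUnion_le
    _ ≤ ∑ q ∈ I.classes, ∑ i, (if I.cls i = q then I.rareLoad v t i else 0) :=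
        Finset.sum_le_sum fun q _ => I.card_overflow_class_le hv t q
    _ = ∑ i, I.rareLoad v t i := by
        rw [Finset.sum_comm]
        refine Finset.sum_congr rfl fun i _ => ?_
        rw [Finset.sum_ite_eq, if_pos (I.cls_mem_classes i)]

lemma card_own_le (hv : 1 ≤ v) {t : ℝ} {s : Finset (Fin I.n)}
    (hs : ∀ i ∈ s, i ∈ I.active t ∧ ∃ m, (I.label k v i).1 = .own m) :
    ((s.image (I.label k v)).card : ℝ) ≤ ∑ i, I.rareLoad v t i := by
  calc _ ≤ (s.card : ℝ) := Nat.cast_le.2 Finset.card_image_le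
    _ = ∑ i ∈ s, (1 : ℝ) := by simp
    _ ≤ ∑ i ∈ s, I.rareLoad v t i := by
        refine Finset.sum_le_sum fun i hi => ?_
        obtain ⟨hi1, m, hm⟩ := hs i hi
        obtain ⟨-, -, h2⟩ := I.large_of_own hm
        rw [mem_active] at hi1
        have hD := I.clsLength_pos (I.cls i)
        have hpos := quota_pos hv (I.cls i)
        rw [rareLoad, Set.indicator_of_mem (show t ∈ Ico _ _ from ⟨hi1.1, by linarith⟩),
          div_mul_eq_mul_div, le_div_iff₀ hpos]
        linarith
    _ ≤ _ := Finset.sum_le_sum_of_subset_of_nonneg (Finset.subset_univ _)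
        fun i _ _ => I.rareLoad_nonneg hv t i

/-! ### The cost of the algorithm for known average load -/

/-- The number of active machines, in terms of the Next-Fit bins of the pending groups. -/
lemma card_label_le (hk : 1 ≤ k) (hv : 1 ≤ v) (t : ℝ) [DecidablePred (I.Pending v t)] {B : ℝ}
    (hB : ∑ p ∈ (I.frequentPools k v t).filter (I.Pending v t),
      (nextFitBins (I.poolSizes k v p (I.arrived t)) : ℝ) ≤
        B + ((I.frequentPools k v t).filter (I.Pending v t)).card) :
    ((I.activeLabels (I.label k v) t).card : ℝ) ≤
      B + (k * (16 * √(v * I.rankBound)) + (8 * √(v * I.rankBound) + 1)) +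
        2 * ∑ i, I.windowLoad v t i + 2 * ∑ i, I.rareLoad v t i := by
  classical
  set F := ((I.active t).filter fun i => 1 ≤ quota v (I.cls i)).image (I.label k v)
  set S := ((I.active t).filter fun i => (I.label k v i).1 = .shared).image (I.label k v)
  set V := ((I.active t).filter fun i => ∃ q, (I.label k v i).1 = .overflow q).image (I.label k v)
  set O := ((I.active t).filter fun i => ∃ m, (I.label k v i).1 = .own m).image (I.label k v)
  have hsub : I.activeLabels (I.label k v) t ⊆ F ∪ (S ∪ (V ∪ O)) := by
    intro x hx
    obtain ⟨i, hi, rfl⟩ := mem_activeLabels.1 hx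
    have hm : ∀ {P : Fin I.n → Prop} [DecidablePred P], P i →
        I.label k v i ∈ ((I.active t).filter P).image (I.label k v) := fun hP =>
      Finset.mem_image_of_mem _ (Finset.mem_filter.2 ⟨hi, hP⟩)
    simp only [Finset.mem_union]
    rcases I.label_cases v i with h | h | h
    · exact Or.inl (hm h)
    · exact Or.inr (Or.inr (Or.inr (hm ⟨i, by rw [I.label_of_large k v h.1 h.2]⟩)))
    · rcases (I.label_of_small k v h.1 h.2).2 with h | h
      · exact Or.inr (Or.inl (hm h.1))
      · exact Or.inr (Or.inr (Or.inl (hm ⟨_, h.1⟩)))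
  have hcard : (I.activeLabels (I.label k v) t).card ≤ F.card + (S.card + (V.card + O.card)) := by
    have h1 := Finset.card_le_card hsub
    have h2 := Finset.card_union_le F (S ∪ (V ∪ O))
    have h3 := Finset.card_union_le S (V ∪ O)
    have h4 := Finset.card_union_le V O
    omega
  have hcard' : ((I.activeLabels (I.label k v) t).card : ℝ) ≤
      F.card + (S.card + (V.card + O.card)) := by exact_mod_cast hcard
  have hF : (F.card : ℝ) ≤ ∑ p ∈ I.frequentPools k v t,
      (nextFitBins (I.poolSizes k v p (I.arrived t)) : ℝ) := by
    exact_mod_cast I.card_frequent_le t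
  rw [← Finset.sum_filter_add_sum_filter_not _ (I.Pending v t)] at hF
  have h1 := I.sum_not_pending_le (k := k) hv t
  have h2 := I.card_frequentPools_le hk hv t
  have h3 := Finset.card_filter_add_card_filter_not (s := I.frequentPools k v t) (I.Pending v t)
  have h3' : (((I.frequentPools k v t).filter (I.Pending v t)).card : ℝ) +
      ((I.frequentPools k v t).filter fun p => ¬ I.Pending v t p).card =
      (I.frequentPools k v t).card := by exact_mod_cast h3
  have hS := I.card_shared_le (k := k) hv t
  have hV : (V.card : ℝ) ≤ _ := I.card_overflow_le (k := k) hv fun i hi => Finset.mem_filter.1 hi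
  have hO : (O.card : ℝ) ≤ _ := I.card_own_le (k := k) hv fun i hi => Finset.mem_filter.1 hi
  linarith

lemma integral_windowLoad (hv : 1 ≤ v) (i : Fin I.n) :
    ∫ t, I.windowLoad v t i ≤ 1 / quota v (I.cls i) * ((I.req i).size * (I.req i).length) := by
  have hδ := I.windowLength_pos hv (I.cls i)
  have hpos := quota_pos hv (I.cls i)
  simp only [windowLoad]
  rw [integral_indicator_Ico_const _ _ _ (by linarith)]
  have h1 : windowLength I.baseLength v (I.cls i) ≤ 1 / quota v (I.cls i) * (I.req i).length := by
    rw [windowLength, div_eq_mul_one_div, mul_comm]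
    have := I.clsLength_le i
    rw [clsLength] at this
    gcongr
  have h2 := mul_le_mul_of_nonneg_left h1 (I.size_pos i).le
  linarith

lemma integral_rareLoad (hv : 1 ≤ v) (i : Fin I.n) :
    ∫ t, I.rareLoad v t i ≤ 6 * (1 / quota v (I.cls i) * ((I.req i).size * (I.req i).length)) := by
  have hD := I.clsLength_pos (I.cls i)
  have hpos := quota_pos hv (I.cls i)
  have hs := I.start_lt_finish i
  simp only [rareLoad]
  rw [integral_indicator_Ico_const _ _ _ (by linarith)]
  have h1 := I.clsLength_le i
  have h2 : (I.req i).finish + 2 * I.clsLength (I.cls i) - (I.req i).start ≤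
      3 * (I.req i).length := by linarith [I.finish_eq i]
  have h3 : 0 ≤ 2 / quota v (I.cls i) * (I.req i).size :=
    mul_nonneg (by positivity) (I.size_pos i).le
  refine (mul_le_mul_of_nonneg_left h2 h3).trans (le_of_eq ?_)
  ring

lemma cost_label_le (hk : 1 ≤ k) {e : Pool × ℕ → ℕ} (he : Function.Injective e) {B : ℝ → ℝ}
    (hBi : Integrable B) (hB0 : ∀ t, 0 ≤ B t) (hB : ∀ t, ∀ s : Finset Pool,
      (∀ p ∈ s, p ∈ I.frequentPools k I.avgLoad t ∧ I.Pending I.avgLoad t p) →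
      ∑ p ∈ s, (nextFitBins (I.poolSizes k I.avgLoad p (I.arrived t)) : ℝ) ≤ B t + s.card) :
    I.cost (fun i => e (I.label k I.avgLoad i)) ≤
      (∫ t, B t) + 39 * k * √(I.avgLoad * I.rankBound) * I.horizon := by
  classical
  have hv := I.one_le_avgLoad
  set v := I.avgLoad with hvdef
  set S := √(v * I.rankBound) with hS
  have hS1 : 1 ≤ S := by
    rw [hS, Real.one_le_sqrt]
    nlinarith [I.two_le_rankBound]
  have hk' : (1 : ℝ) ≤ k := by exact_mod_cast hk
  have hT := I.horizon_pos
  set c := (k : ℝ) * (16 * S) + (8 * S + 1) with hc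
  rw [I.cost_eq_integral _ _ he]
  have hwi' : ∀ i, Integrable fun t => I.windowLoad v t i :=
    fun i => integrable_indicator_Ico_const _ _ _
  have hri' : ∀ i, Integrable fun t => I.rareLoad v t i :=
    fun i => integrable_indicator_Ico_const _ _ _
  have hwi : Integrable fun t => ∑ i, I.windowLoad v t i :=
    integrable_finsetSum _ fun i _ => hwi' i
  have hri : Integrable fun t => ∑ i, I.rareLoad v t i :=
    integrable_finsetSum _ fun i _ => hri' i
  have hci : Integrable fun t => (Ico I.first I.last).indicator (fun _ => c) t :=
    integrable_indicator_Ico_const _ _ _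
  have hi₁ : Integrable fun t => B t + (Ico I.first I.last).indicator (fun _ => c) t := hBi.add hci
  have hi₂ : Integrable fun t => B t + (Ico I.first I.last).indicator (fun _ => c) t +
      2 * ∑ i, I.windowLoad v t i := hi₁.add (hwi.const_mul 2)
  have step : ∫ t, ((I.activeLabels (I.label k v) t).card : ℝ) ≤
      ∫ t, (((B t + (Ico I.first I.last).indicator (fun _ => c) t) +
        2 * ∑ i, I.windowLoad v t i) + 2 * ∑ i, I.rareLoad v t i) := by
    refine integral_mono (I.integrable_card_activeLabels _)
      (hi₂.add (hri.const_mul 2)) fun t => ?_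
    by_cases ht : t ∈ Ico I.first I.last
    · rw [Set.indicator_of_mem ht]
      refine I.card_label_le hk hv t (hB t _ fun p hp => Finset.mem_filter.1 hp)
    · rw [Set.indicator_of_notMem ht]
      have : I.activeLabels (I.label k v) t = ∅ := by
        rw [← active_nonempty_iff, Finset.not_nonempty_iff_eq_empty] at ht
        rw [activeLabels_eq, ht, Finset.image_empty]
      rw [this, Finset.card_empty, Nat.cast_zero]
      have h1 : 0 ≤ ∑ i, I.windowLoad v t i := Finset.sum_nonneg fun i _ => I.windowLoad_nonneg t i
      have h2 : 0 ≤ ∑ i, I.rareLoad v t i := Finset.sum_nonneg fun i _ => I.rareLoad_nonneg hv t i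
      have h3 := hB0 t
      linarith
  refine step.trans ?_
  rw [integral_add hi₂ (hri.const_mul 2),
    integral_add hi₁ (hwi.const_mul 2), integral_add hBi hci, integral_horizon,
    integral_const_mul, integral_const_mul,
    integral_finsetSum _ fun i _ => hwi' i, integral_finsetSum _ fun i _ => hri' i]
  -- The volume of the requests is at most `v * I.horizon`, and each request is charged its volume
  -- divided by the quota of its class.
  have hvol : ∑ i, 1 / quota v (I.cls i) * ((I.req i).size * (I.req i).length) ≤
      S * I.horizon := by
    calc _ ≤ ∑ i, √(I.rankBound / v) * ((I.req i).size * (I.req i).length) := by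
          refine Finset.sum_le_sum fun i _ => mul_le_mul_of_nonneg_right (I.one_div_quota_le hv i)
            (mul_nonneg (I.size_pos i).le (I.length_pos i).le)
      _ ≤ √(I.rankBound / v) * (v * I.horizon) := by
          rw [← Finset.mul_sum]
          gcongr
          exact I.volume_le
      _ = S * I.horizon := by
          have hv0 : 0 < v := by linarith
          have : √(I.rankBound / v) * v = S := by
            have hR := I.two_le_rankBound
            rw [hS, ← Real.sqrt_sq hv0.le, ← Real.sqrt_mul (by positivity), Real.sqrt_sq hv0.le]
            congr 1
            field_simp
          rw [← mul_assoc, this]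
  have hw : ∑ i, ∫ t, I.windowLoad v t i ≤ S * I.horizon :=
    (Finset.sum_le_sum fun i _ => I.integral_windowLoad hv i).trans hvol
  have hr : ∑ i, ∫ t, I.rareLoad v t i ≤ 6 * (S * I.horizon) := by
    refine (Finset.sum_le_sum fun i _ => I.integral_rareLoad hv i).trans ?_
    rw [← Finset.mul_sum]
    linarith
  -- `14 = 2 + 12` comes from the charges, and `39 = 16 + 8 + 1 + 14`.
  have hc' : c + 14 * S ≤ 39 * k * S := by
    rw [hc]
    nlinarith
  have := mul_le_mul_of_nonneg_right hc' hT.le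
  linarith

/-- The pending groups, packed by Next-Fit in each group, compare with a static packing of the
active requests by Harmonic. -/
lemma sum_pending_le_harmonic (hk : 1 ≤ k) (hv : 1 ≤ v) {σ : Fin I.n → ℕ} (hσ : I.Feasible σ)
    (t : ℝ) (s : Finset Pool) (hs : ∀ p ∈ s, p ∈ I.frequentPools k v t ∧ I.Pending v t p) :
    ∑ p ∈ s, (nextFitBins (I.poolSizes k v p (I.arrived t)) : ℝ) ≤
      (harmonicRatio k * (I.activeLabels σ t).card +
        (Ico I.first I.last).indicator (fun _ => (k : ℝ)) t) + s.card := by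
  rcases s.eq_empty_or_nonempty with rfl | ⟨p₀, hp₀⟩
  · simp only [Finset.sum_empty, Finset.card_empty, Nat.cast_zero, add_zero]
    exact add_nonneg (mul_nonneg (harmonicRatio_nonneg k) (Nat.cast_nonneg _))
      (Set.indicator_nonneg (fun _ _ => Nat.cast_nonneg _) t)
  · have ht : t ∈ Ico I.first I.last := by
      obtain ⟨i, hi, -⟩ := Finset.mem_image.1 (hs p₀ hp₀).1
      exact I.active_nonempty_iff.1 ⟨i, (Finset.mem_filter.1 hi).1⟩
    rw [Set.indicator_of_mem ht]
    set ls : List (List (Fin I.n)) := s.toList.map fun p =>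
      (I.arrived t).filter fun i => (I.label k v i).1 = p with hls
    have hsizes : s.toList.map (fun p => I.poolSizes k v p (I.arrived t)) =
        ls.map (List.map fun i => (I.req i).size) := by
      rw [hls, List.map_map]; rfl
    have hflat : (s.toList.map fun p => I.poolSizes k v p (I.arrived t)).flatten =
        ls.flatten.map fun i => (I.req i).size := by
      rw [hsizes, List.map_flatten]
    have hmem : ∀ i ∈ ls.flatten, i ∈ I.active t := by
      intro i hi
      obtain ⟨l, hl, hil⟩ := List.mem_flatten.1 hi
      obtain ⟨p, hp, rfl⟩ := List.mem_map.1 hl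
      rw [List.mem_filter, decide_eq_true_eq] at hil
      refine I.mem_active_of_pending (k := k) hv hil.1 ?_
      rw [hil.2]
      exact (hs p (Finset.mem_toList.1 hp)).2
    have hnodup : ls.flatten.Nodup := by
      rw [List.nodup_flatten]
      constructor
      · intro l hl
        obtain ⟨p, hp, rfl⟩ := List.mem_map.1 hl
        exact ((List.nodup_finRange I.n).filter _).filter _
      · rw [hls, List.pairwise_map]
        refine s.nodup_toList.imp fun {p p'} hpp' => ?_
        rw [List.disjoint_left]
        intro i hi hi'
        rw [List.mem_filter, decide_eq_true_eq] at hi hi'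
        exact hpp' (hi.2.symm.trans hi'.2)
    have hvalid : ∀ l : List (Fin I.n), ValidItems (l.map fun i => (I.req i).size) := by
      intro l w hw
      obtain ⟨i, -, rfl⟩ := List.mem_map.1 hw
      exact ⟨I.size_pos i, I.size_le_one i⟩
    have h1 := sum_nextFitBins_le k (s.toList.map fun p => I.poolSizes k v p (I.arrived t)) ?_ ?_
    · have h2 := harmonicBins_le k (hvalid ls.flatten)
      have h3 := I.staticOpt_active_le hσ hnodup hmem
      have h4 : harmonicRatio k * (staticOpt (ls.flatten.map fun i => (I.req i).size) : ℝ) ≤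
          harmonicRatio k * (I.activeLabels σ t).card :=
        mul_le_mul_of_nonneg_left (Nat.cast_le.2 h3) (harmonicRatio_nonneg k)
      rw [hflat, List.length_map, Finset.length_toList, List.map_map] at h1
      have h5 : ((s.toList.map (nextFitBins ∘ fun p =>
          I.poolSizes k v p (I.arrived t))).sum : ℕ) =
          ∑ p ∈ s, nextFitBins (I.poolSizes k v p (I.arrived t)) := Finset.sum_map_toList _ _
      rw [h5] at h1
      have h6 : ∑ p ∈ s, (nextFitBins (I.poolSizes k v p (I.arrived t)) : ℝ) ≤
          harmonicBins k (ls.flatten.map fun i => (I.req i).size) + s.card := by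
        exact_mod_cast h1
      linarith
    · intro g hg
      obtain ⟨p, -, rfl⟩ := List.mem_map.1 hg
      exact hvalid _
    · intro g hg
      obtain ⟨p, hp, rfl⟩ := List.mem_map.1 hg
      obtain ⟨q, j, κ, rfl, -⟩ := (hs p (Finset.mem_toList.1 hp)).2
      obtain ⟨x, -, hxp⟩ := Finset.mem_image.1 (hs _ (Finset.mem_toList.1 hp)).1
      refine ⟨κ, ?_, fun w hw => ?_⟩
      · rw [(I.frequent_of_label hxp).2.2.2]
        exact harmonicIndex_mem hk (I.size_pos x) (I.size_le_one x)
      · obtain ⟨i, hi, rfl⟩ := List.mem_map.1 hw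
        rw [List.mem_filter, decide_eq_true_eq] at hi
        exact (I.frequent_of_label hi.2).2.2.2.symm

/-- For uniform sizes, Next-Fit wastes no space in the pending groups. -/
lemma sum_pending_le_load (hI : I.Uniform) (hv : 1 ≤ v) (t : ℝ) (s : Finset Pool)
    (hs : ∀ p ∈ s, p ∈ I.frequentPools k v t ∧ I.Pending v t p) :
    ∑ p ∈ s, (nextFitBins (I.poolSizes k v p (I.arrived t)) : ℝ) ≤ I.loadVec t + s.card := by
  obtain ⟨g, hg, hw⟩ := hI
  calc _ ≤ ∑ p ∈ s, ((I.poolSizes k v p (I.arrived t)).sum + 1) := by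
        refine Finset.sum_le_sum fun p _ => nextFitBins_le_of_uniform hg fun w hwm => ?_
        obtain ⟨i, -, rfl⟩ := List.mem_map.1 hwm
        exact hw i
    _ = ∑ p ∈ s, (I.poolSizes k v p (I.arrived t)).sum + s.card := by
        rw [Finset.sum_add_distrib]; simp
    _ ≤ _ := by
        gcongr
        refine le_trans ?_ (I.load_le_loadVec t)
        rw [load_eq]
        simp only [poolSizes_arrived_sum]
        rw [Finset.sum_comm, active, Finset.sum_filter]
        refine Finset.sum_le_sum fun i _ => ?_
        have e : ∀ p ∈ s, (if (I.req i).start ≤ t ∧ (I.label k v i).1 = p then (I.req i).size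
            else 0) = if (I.label k v i).1 = p then
              (if (I.req i).start ≤ t then (I.req i).size else 0) else 0 := by
          intro p _
          split_ifs <;> simp_all
        rw [Finset.sum_congr rfl e, Finset.sum_ite_eq]
        have := (I.size_pos i).le
        split_ifs with h1 h2 h3 h3 h3
        · exact le_rfl
        · refine absurd (mem_active.1 (I.mem_active_of_pending (k := k) hv ?_ (hs _ h1).2)) h3
          simpa [arrived] using h2
        · exact this
        · exact le_rfl
        · exact this
        · exact le_rfl

end Instance

/-- The online algorithm that follows `avgLoadRule k`. -/
def avgLoadAlgorithm (k : ℕ) (e : Pool × ℕ → ℕ) : AvgLoadAlgorithm :=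
  fun v l => e (lastDecision (avgLoadRule k v) l)

lemma avgLoadAlgorithm_run (k : ℕ) (e : Pool × ℕ → ℕ) (I : Instance) :
    (avgLoadAlgorithm k e).run I = fun i => e (I.label k I.avgLoad i) := by
  ext i
  simp only [AvgLoadAlgorithm.run, avgLoadAlgorithm, Instance.label]
  rw [lastDecision_take]

lemma avgLoadAlgorithm_feasible (k : ℕ) {e : Pool × ℕ → ℕ} (he : Function.Injective e)
    (I : Instance) : I.Feasible ((avgLoadAlgorithm k e).run I) := by
  rw [avgLoadAlgorithm_run]
  exact I.feasible_of_labels he I.label_fits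

lemma Instance.sqrt_avgLoad_le (I : Instance) :
    √(I.avgLoad * I.rankBound) ≤ 2 * √(I.optAvg * (1 + Real.log I.mu)) := by
  have h1 := I.avgLoad_le_optAvg
  have h2 := I.two_le_rankBound
  have h3 := I.optAvg_nonneg
  rw [Instance.rankBound] at h2 ⊢
  rw [Real.sqrt_le_left (by positivity), mul_pow, Real.sq_sqrt (by nlinarith)]
  nlinarith

lemma avgLoadAlgorithm_le {k : ℕ} (hk : 1 ≤ k) {e : Pool × ℕ → ℕ} (he : Function.Injective e)
    (I : Instance) : I.avgCost ((avgLoadAlgorithm k e).run I) ≤ harmonicRatio k * I.optAvg +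
      k * (80 * √(I.optAvg * (1 + Real.log I.mu))) := by
  have hT := I.horizon_pos
  have hS1 : 1 ≤ √(I.avgLoad * I.rankBound) := by
    rw [Real.one_le_sqrt]
    nlinarith [I.two_le_rankBound, I.one_le_avgLoad]
  have hk0 : (0 : ℝ) ≤ k := Nat.cast_nonneg k
  have main : I.cost ((avgLoadAlgorithm k e).run I) ≤ harmonicRatio k * I.opt +
      40 * k * √(I.avgLoad * I.rankBound) * I.horizon := by
    refine I.le_mul_opt_add (harmonicRatio_nonneg k) fun σ hσ => ?_
    rw [avgLoadAlgorithm_run]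
    have hint1 : Integrable fun t => harmonicRatio k * ((I.activeLabels σ t).card : ℝ) :=
      (I.integrable_card_activeLabels σ).const_mul _
    have hint2 : Integrable fun t => (Ico I.first I.last).indicator (fun _ => (k : ℝ)) t :=
      Instance.integrable_indicator_Ico_const _ _ _
    have h1 := I.cost_label_le hk he (hint1.add hint2) (fun t =>
        add_nonneg (mul_nonneg (harmonicRatio_nonneg k) (Nat.cast_nonneg _))
          (Set.indicator_nonneg (fun _ _ => hk0) t))
      (I.sum_pending_le_harmonic hk I.one_le_avgLoad hσ)
    simp only [Pi.add_apply] at h1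
    rw [integral_add hint1 hint2, integral_const_mul, ← I.cost_eq_integral_self,
      I.integral_horizon] at h1
    have h2 : (k : ℝ) * I.horizon ≤ k * √(I.avgLoad * I.rankBound) * I.horizon := by
      rw [mul_assoc]
      refine mul_le_mul_of_nonneg_left ?_ hk0
      nlinarith
    linarith
  rw [Instance.avgCost, div_le_iff₀ hT]
  have h3 := I.sqrt_avgLoad_le
  have h4 : harmonicRatio k * I.optAvg * I.horizon = harmonicRatio k * I.opt := by
    rw [mul_assoc, Instance.optAvg, div_mul_cancel₀ _ hT.ne']
  have h5 := mul_le_mul_of_nonneg_left h3 (mul_nonneg hk0 hT.le)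
  rw [add_mul, h4]
  linarith

lemma avgLoadAlgorithm_one_le {e : Pool × ℕ → ℕ} (he : Function.Injective e) (I : Instance)
    (hI : I.Uniform) : I.avgCost ((avgLoadAlgorithm 1 e).run I) ≤ I.optAvg +
      80 * √(I.optAvg * (1 + Real.log I.mu)) := by
  have hT := I.horizon_pos
  have h1 := I.cost_label_le le_rfl he I.integrable_loadVec (fun t => Nat.cast_nonneg _)
    (I.sum_pending_le_load hI I.one_le_avgLoad)
  rw [← I.avgLoad_mul_horizon] at h1
  rw [Instance.avgCost, div_le_iff₀ hT, avgLoadAlgorithm_run]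
  have h2 := mul_le_mul_of_nonneg_right I.sqrt_avgLoad_le hT.le
  have h3 := mul_le_mul_of_nonneg_right I.avgLoad_le_optAvg hT.le
  have h4 : 0 ≤ √(I.optAvg * (1 + Real.log I.mu)) * I.horizon := by positivity
  push_cast at h1
  linarith

end DynamicBinPacking

end

theorem theorem2 :
    (∃ C : ℝ, 0 < C ∧
      (∀ k : ℕ, 2 ≤ k → ∃ A : DynamicBinPacking.AvgLoadAlgorithm,
        ∀ I : DynamicBinPacking.Instance,
          I.Feasible (A.run I) ∧
          I.avgCost (A.run I) ≤ DynamicBinPacking.harmonicRatio k * I.optAvg +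
            (k : ℝ) * (C * Real.sqrt (I.optAvg * (1 + Real.log I.mu)))) ∧
      (∃ A : DynamicBinPacking.AvgLoadAlgorithm,
        ∀ I : DynamicBinPacking.Instance, I.Uniform →
          I.Feasible (A.run I) ∧
          I.avgCost (A.run I) ≤ I.optAvg +
            C * Real.sqrt (I.optAvg * (1 + Real.log I.mu)))) ∧
    (∃ A : DynamicBinPacking.LoadVectorAlgorithm,
      ∀ I : DynamicBinPacking.Instance,
        I.Feasible (A.run I) ∧ I.avgCost (A.run I) ≤ 8 * I.optAvg) ∧
    (∃ A : DynamicBinPacking.LoadVectorAlgorithm,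
      ∀ I : DynamicBinPacking.Instance, I.Uniform →
        I.Feasible (A.run I) ∧ I.avgCost (A.run I) ≤ 2 * I.optAvg) := by
  open DynamicBinPacking in
  obtain ⟨e, he⟩ := exists_injective_nat (Pool × ℕ)
  exact ⟨⟨80, by norm_num,
    fun k hk => ⟨avgLoadAlgorithm k e, fun I =>
      ⟨avgLoadAlgorithm_feasible k he I, avgLoadAlgorithm_le (by omega) he I⟩⟩,
    ⟨avgLoadAlgorithm 1 e, fun I hI =>
      ⟨avgLoadAlgorithm_feasible 1 he I, avgLoadAlgorithm_one_le he I hI⟩⟩⟩,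
    ⟨stripAlgorithm (1 / 2), fun I => ⟨stripAlgorithm_feasible _ I, stripAlgorithm_half_le I⟩⟩,
    ⟨stripAlgorithm 1, fun I hI =>
      ⟨stripAlgorithm_feasible _ I, stripAlgorithm_one_le I hI⟩⟩⟩
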